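/- A plane multigraph $G=(V,E)$ consists of a finite set $V$ of distinct points in the Euclidean plane (the vertices) and a family $E$ of edges (loops and parallel edges are allowed), where each edge is a Jordan arc between two distinct vertices, or a Jordan curve through one vertex in the case of a loop, that passes through no vertex other than its endpoints, and any two distinct edges intersect only at vertices. A plane ortho-fin multigraph is a plane multigraph in which every edge is a polygonal path $(p_0,p_1,\ldots,p_k)$, $k\geq 1$, with nondegenerate segments, whose first and last segments are parallel or orthogonal, that is, $p_0p_1\parallel p_{k-1}p_k$ or $p_0p_1\perp p_{k-1}p_k$. **Theorem.** For every $n\geq 1$, every plane ortho-fin multigraph on $n$ vertices has at most $5n-2$ edges, and this bound is the best possible: for every $n\geq 1$ there is a plane ortho-fin multigraph with exactly $n$ vertices and $5n-2$ edges. -/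

import Mathlib

/-- The Euclidean plane. -/
abbrev Plane : Type := EuclideanSpace ℝ (Fin 2)

/-- A simple polygonal path `(p₀, p₁, …, p_k)` in the plane, with `k = bends + 1 ≥ 1` segments.
Each segment is nondegenerate, and the path does not meet itself, except that consecutive segments
share their common endpoint and that `p₀ = p_k` is allowed. So the path traces
a Jordan arc (if `p₀ ≠ p_k`) or a Jordan curve through `p₀` (if `p₀ = p_k`). -/
structure PolygonalPath where
  /-- the number of bends `p₁, …, p_{k-1}` -/
  bends : ℕ
  /-- the points `p₀, …, p_k` -/
  pt : Fin (bends + 2) → Plane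
  pt_ne : ∀ i : Fin (bends + 1), pt i.castSucc ≠ pt i.succ
  simple : ∀ i j : Fin (bends + 1), i < j →
    ∀ x ∈ segment ℝ (pt i.castSucc) (pt i.succ), x ∈ segment ℝ (pt j.castSucc) (pt j.succ) →
      (i.succ = j.castSucc ∧ x = pt i.succ) ∨
      (i = 0 ∧ j = Fin.last bends ∧ x = pt 0 ∧ x = pt (Fin.last (bends + 1)))

namespace PolygonalPath

/-- The first endpoint `p₀`. -/
def source (γ : PolygonalPath) : Plane := γ.pt 0

/-- The last endpoint `p_k`. -/
def target (γ : PolygonalPath) : Plane := γ.pt (Fin.last (γ.bends + 1))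

/-- The set of all points on the path. -/
def carrier (γ : PolygonalPath) : Set Plane :=
  ⋃ i : Fin (γ.bends + 1), segment ℝ (γ.pt i.castSucc) (γ.pt i.succ)

/-- The direction vector of the `i`-th segment. -/
def dir (γ : PolygonalPath) (i : Fin (γ.bends + 1)) : Plane := γ.pt i.succ - γ.pt i.castSucc

/-- The first and the last segment are parallel or orthogonal. -/
def IsOrthoFin (γ : PolygonalPath) : Prop :=
  (∃ c : ℝ, γ.dir (Fin.last γ.bends) = c • γ.dir 0) ∨
    inner ℝ (γ.dir 0) (γ.dir (Fin.last γ.bends)) = 0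

end PolygonalPath

/-- A plane multigraph with polygonal edges, indexed by `E`. Loops and parallel edges are allowed.
The vertices are finitely many points; an edge joins two (possibly equal) vertices and passes
through no other vertex; distinct edges meet only at vertices. -/
structure PlaneMultigraph (E : Type*) where
  verts : Finset Plane
  edge : E → PolygonalPath
  source_mem : ∀ e, (edge e).source ∈ verts
  target_mem : ∀ e, (edge e).target ∈ verts
  vertex_on_edge : ∀ e, ∀ v ∈ verts, v ∈ (edge e).carrier →
    v = (edge e).source ∨ v = (edge e).target
  edge_inter : ∀ e f, e ≠ f → (edge e).carrier ∩ (edge f).carrier ⊆ verts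

/-- A plane ortho-fin multigraph: the first and the last segment of every edge are parallel or
orthogonal. -/
def PlaneMultigraph.IsOrthoFin {E : Type*} (G : PlaneMultigraph E) : Prop :=
  ∀ e, (G.edge e).IsOrthoFin

/-! For the upper bound, each edge is split into two darts, one per end. At each vertex the darts
are ordered cyclically by direction (`σ`). Reversing a dart and then applying `σ` permutes the
darts, and the cycles of this permutation serve as the faces. The angles between consecutive darts
add up to at most `2π` per vertex. Along one face the directions telescope, and an ortho-fin edge
changes the direction only by a multiple of `π / 2`; so the angle sum of a face is a positive
integer multiple of `π / 2`. Hence there are at most `4n` faces (`sum_cyclicGap_le`,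
`card_faces_mul_le_sum_cyclicGap`).

It remains to show `|E| + 2 ≤ |V| + |F|`, the half of Euler's formula that needs no connectedness.
The cycle space has dimension at least `|E| - |V| + 1`, and differences of face potentials form a
space of dimension at most `|F| - 1`, so it suffices that every cycle is such a difference
(`card_add_two_le_of_cycles_bound`). The potential is the winding number, written as a sum of
complex logarithms over the segments. It is locally constant off the drawing, jumps by `2πi z e`
across the edge `e` (`winding_sub_winding`), and agrees along a face because neighbouring sides are
joined off the drawing by thin triangles and by sectors at vertices and bends
(`joinedIn_of_cyclicSucc`, `joinedIn_reverse`). Together, `|E| + 2 ≤ n + 4n`.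

For sharpness, three nested loops at a vertex enclose angles of 90, 180 and 270 degrees and leave a
quadrant free. Two parallel edges from an older vertex arrive in this quadrant and leave room
between them for a rotated, shrunken copy of the previous drawing. Each such step adds one vertex
and five edges; closing with three loops only gives `5m + 3 = 5(m + 1) - 2` edges on `m + 1`
vertices. -/

/-! ### Cyclic order at the vertices and the angle count. -/

open Real in
/-- The angle of the positive rotation from direction `x` to direction `y`, in `(0, 2π]` for
`x, y ∈ (-π, π]`. -/
noncomputable def cyclicGap (x y : ℝ) : ℝ := y - x + if x < y then 0 else 2 * π

/-- `y` is the cyclic successor of `x` in `A`. -/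
def CyclicSucc (A : Set ℝ) (x y : ℝ) : Prop :=
  -- The second case allows `x = y`: a lone dart is its own successor, with gap `2π`.
  (x < y ∧ ∀ a ∈ A, ¬ (x < a ∧ a < y)) ∨ (y ≤ x ∧ ∀ a ∈ A, y ≤ a ∧ a ≤ x)

/-- The successor is the next larger direction, or the smallest one after the largest. Distinctness
of the directions at a vertex makes this map injective, hence a permutation. -/
theorem exists_perm_cyclicSucc {D V : Type*} [Finite D] (vtx : D → V) (f : D → ℝ)
    (hf : ∀ d d', vtx d = vtx d' → f d = f d' → d = d') :
    ∃ σ : Equiv.Perm D, ∀ d, vtx (σ d) = vtx d ∧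
      CyclicSucc (f '' {d' | vtx d' = vtx d}) (f d) (f (σ d)) := by
  have key : ∀ d, ∃ d', vtx d' = vtx d ∧
      CyclicSucc (f '' {d' | vtx d' = vtx d}) (f d) (f d') := by
    intro d
    by_cases h : ({d' | vtx d' = vtx d ∧ f d < f d'} : Set D).Nonempty
    · obtain ⟨m, hm, hmin⟩ := Set.exists_min_image _ f (Set.toFinite _) h
      refine ⟨m, hm.1, Or.inl ⟨hm.2, ?_⟩⟩
      rintro _ ⟨e, he, rfl⟩ ⟨h1, h2⟩
      exact absurd (hmin e ⟨he, h1⟩) (not_le.2 h2)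
    · obtain ⟨m, hm, hmin⟩ := Set.exists_min_image {d' | vtx d' = vtx d} f (Set.toFinite _) ⟨d, rfl⟩
      refine ⟨m, hm, Or.inr ⟨hmin d rfl, ?_⟩⟩
      rintro _ ⟨e, he, rfl⟩
      refine ⟨hmin e he, ?_⟩
      by_contra hc
      exact h ⟨e, he, not_le.1 hc⟩
  choose s hs1 hs2 using key
  have hinj : Function.Injective s := by
    have main : ∀ a b, s a = s b → ¬ f a < f b := by
      intro a b hab hlt
      have hv : vtx a = vtx b := by rw [← hs1 a, ← hs1 b, hab]
      have ha := hs2 a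
      have hb := hs2 b
      rw [← hab] at hb
      rcases ha with ⟨h1, h2⟩ | ⟨h1, h2⟩
      · have h3 := h2 (f b) ⟨b, hv.symm, rfl⟩
        rcases hb with ⟨h4, h5⟩ | ⟨h4, h5⟩
        · exact h3 ⟨hlt, h4⟩
        · have := (h5 (f a) ⟨a, hv, rfl⟩).1
          linarith
      · have := (h2 (f b) ⟨b, hv.symm, rfl⟩).2
        linarith
    intro a b hab
    have hv : vtx a = vtx b := by rw [← hs1 a, ← hs1 b, hab]
    exact hf a b hv (le_antisymm (not_lt.1 (main b a hab.symm)) (not_lt.1 (main a b hab)))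
  refine ⟨Equiv.ofBijective s (Finite.injective_iff_bijective.1 hinj), fun d => ⟨hs1 d, hs2 d⟩⟩

-- The differences cancel because `σ` is a permutation. A term `2π` remains only for a dart of
-- maximal direction at its vertex, so at most once per vertex.
open Real in
theorem sum_cyclicGap_le {D V : Type*} [Fintype D] [Fintype V] (vtx : D → V) (f : D → ℝ)
    (hf : ∀ d d', vtx d = vtx d' → f d = f d' → d = d') (σ : Equiv.Perm D)
    (hσ : ∀ d, CyclicSucc (f '' {d' | vtx d' = vtx d}) (f d) (f (σ d))) :
    ∑ d, cyclicGap (f d) (f (σ d)) ≤ 2 * π * Fintype.card V := by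
  classical
  have h1 : ∑ d, cyclicGap (f d) (f (σ d)) =
      2 * π * (Finset.univ.filter fun d => ¬ f d < f (σ d)).card := by
    simp only [cyclicGap, Finset.sum_add_distrib, Finset.sum_sub_distrib]
    rw [Equiv.sum_comp σ f, sub_self, zero_add, Finset.sum_ite]
    simp [mul_comm]
  rw [h1]
  have h2 : (Finset.univ.filter fun d => ¬ f d < f (σ d)).card ≤ Fintype.card V := by
    rw [← Finset.card_univ]
    refine Finset.card_le_card_of_injOn vtx (fun _ _ => Finset.mem_coe.2 (Finset.mem_univ _)) ?_
    intro a ha b hb hab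
    have ha' : ¬ f a < f (σ a) := by simpa using ha
    have hb' : ¬ f b < f (σ b) := by simpa using hb
    have h3 := (hσ a).resolve_left (fun h => ha' h.1)
    have h4 := (hσ b).resolve_left (fun h => hb' h.1)
    exact hf a b hab (le_antisymm (h4.2 _ ⟨a, hab, rfl⟩).2 (h3.2 _ ⟨b, hab.symm, rfl⟩).2)
  have : (0:ℝ) ≤ 2 * π := by positivity
  exact mul_le_mul_of_nonneg_left (by exact_mod_cast h2) this

open Real in
/-- If the directions at the two ends of every edge agree modulo `π / 2`, then every face has angle
sum at least `π / 2`. -/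
theorem card_faces_mul_le_sum_cyclicGap {D : Type*} [Fintype D] (f : D → ℝ)
    (hfl : ∀ d, -π < f d) (hfu : ∀ d, f d ≤ π)
    (σ rev : Equiv.Perm D) (hrev : ∀ d, ∃ m : ℤ, f (rev d) = f d + m * (π / 2)) :
    (Nat.card (Quotient (Equiv.Perm.SameCycle.setoid (rev.trans σ))) : ℝ) * (π / 2) ≤
      ∑ d, cyclicGap (f d) (f (σ d)) := by
  classical
  set ψ := rev.trans σ with hψ
  choose m hm using hrev
  let _ : Fintype (Quotient (Equiv.Perm.SameCycle.setoid ψ)) := Fintype.ofFinite _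
  -- After reindexing by `rev`, the angle from `rev d` to `ψ d` is charged to the face of `d`.
  rw [← Equiv.sum_comp rev (fun d => cyclicGap (f d) (f (σ d)))]
  rw [← Finset.sum_fiberwise Finset.univ
    (fun d => (Quotient.mk (Equiv.Perm.SameCycle.setoid ψ) d))]
  rw [Nat.card_eq_fintype_card, ← nsmul_eq_mul, ← Finset.card_univ]
  refine Finset.card_nsmul_le_sum _ _ _ fun q _ => ?_
  set C := Finset.univ.filter fun d => Quotient.mk (Equiv.Perm.SameCycle.setoid ψ) d = q with hC
  -- `ψ` permutes each of its cycles, so the directions telescope around the face.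
  have hinv : ∑ d ∈ C, f (σ (rev d)) = ∑ d ∈ C, f d := by
    refine Finset.sum_bij (fun d _ => ψ d) ?_ ?_ ?_ ?_
    · intro d hd
      simp only [hC, Finset.mem_filter, Finset.mem_univ, true_and] at hd ⊢
      rw [← hd]
      refine Quotient.sound ?_
      change Equiv.Perm.SameCycle ψ (ψ d) d
      rw [Equiv.Perm.sameCycle_apply_left]
    · intro a _ b _ h
      exact ψ.injective h
    · intro d hd
      refine ⟨ψ.symm d, ?_, by simp⟩
      simp only [hC, Finset.mem_filter, Finset.mem_univ, true_and] at hd ⊢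
      rw [← hd]
      refine Quotient.sound ?_
      change Equiv.Perm.SameCycle ψ (ψ.symm d) d
      rw [← Equiv.Perm.sameCycle_apply_left, Equiv.apply_symm_apply]
    · intro d _
      rfl
  have hpos : 0 < ∑ d ∈ C, cyclicGap (f (rev d)) (f (σ (rev d))) := by
    refine Finset.sum_pos ?_ ?_
    · intro d _
      unfold cyclicGap
      split_ifs with h
      · linarith
      · have := hfl (σ (rev d))
        have := hfu (rev d)
        linarith
    · induction q using Quotient.inductionOn with
      | h d => exact ⟨d, by simp [hC]⟩
  -- What survives is an integer multiple of `π / 2`: a wrap-around `2π` counts as `4`. Being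
  -- positive, the integer is at least `1`.
  have hint : ∑ d ∈ C, cyclicGap (f (rev d)) (f (σ (rev d))) =
      ((∑ d ∈ C, ((if f (rev d) < f (σ (rev d)) then 0 else 4) - m d) : ℤ) : ℝ) * (π / 2) := by
    push_cast
    rw [Finset.sum_mul]
    have : ∀ d ∈ C, cyclicGap (f (rev d)) (f (σ (rev d))) = (f (σ (rev d)) - f d) +
        ((if f (rev d) < f (σ (rev d)) then 0 else 4) - m d) * (π / 2) := by
      intro d _
      unfold cyclicGap
      conv_lhs => rw [hm d]
      rw [hm d]
      split_ifs <;> ring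
    rw [Finset.sum_congr rfl this, Finset.sum_add_distrib, Finset.sum_sub_distrib, hinv]
    simp
  rw [hint] at hpos ⊢
  have hpi : 0 < π / 2 := by positivity
  have h0 := pos_of_mul_pos_left hpos hpi.le
  have h1 : (1 : ℝ) ≤ ((∑ d ∈ C, ((if f (rev d) < f (σ (rev d)) then 0 else 4) - m d) : ℤ) : ℝ) := by
    exact_mod_cast Int.cast_pos.1 h0
  nlinarith

/-! ### Euler's inequality by linear algebra. -/

/-- If every cycle of a multigraph is a difference of face potentials, then the number of edges is
at most the number of vertices plus the number of faces minus two. -/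
theorem card_add_two_le_of_cycles_bound {E V F : Type*} [Fintype E] [Fintype V] [Fintype F]
    [Nonempty E] (s t : E → V) (l r : E → F)
    (h : ∀ z : E → ℂ, (∀ g : V → ℂ, ∑ e, z e * (g (t e) - g (s e)) = 0) →
      ∃ w : F → ℂ, ∀ e, z e = w (l e) - w (r e)) :
    Fintype.card E + 2 ≤ Fintype.card V + Fintype.card F := by
  classical
  obtain ⟨e₀⟩ := ‹Nonempty E›
  let bd : (E → ℂ) →ₗ[ℂ] (V → ℂ) :=
    { toFun := fun z v => ∑ e, z e * ((if t e = v then 1 else 0) - (if s e = v then 1 else 0))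
      map_add' := by
        intro x y; ext v; simp [add_mul, Finset.sum_add_distrib]
      map_smul' := by
        intro c x; ext v; simp [Finset.mul_sum, mul_assoc] }
  let co : (F → ℂ) →ₗ[ℂ] (E → ℂ) :=
    { toFun := fun w e => w (l e) - w (r e)
      map_add' := by
        intro x y; ext e; simp; ring
      map_smul' := by
        intro c x; ext e; simp [mul_sub] }
  let tot : Module.Dual ℂ (V → ℂ) :=
    { toFun := fun x => ∑ v, x v
      map_add' := by
        intro x y; simp [Finset.sum_add_distrib]
      map_smul' := by
        intro c x; simp [Finset.mul_sum] }
  have htot : tot ≠ 0 := by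
    intro h0
    have := LinearMap.congr_fun h0 (Pi.single (s e₀) 1)
    simp [tot] at this
  -- Boundaries have coordinate sum zero, so they lie in the kernel of a nonzero functional.
  have h1 : Module.finrank ℂ (LinearMap.range bd) + 1 ≤ Fintype.card V := by
    have h2 := Module.Dual.finrank_ker_add_one_of_ne_zero htot
    rw [Module.finrank_fintype_fun_eq_card] at h2
    rw [← h2]
    gcongr
    refine Submodule.finrank_mono ?_
    rintro _ ⟨z, rfl⟩
    simp only [LinearMap.mem_ker]
    change ∑ v, ∑ e, _ = _
    rw [Finset.sum_comm]
    refine Finset.sum_eq_zero fun e _ => ?_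
    rw [← Finset.mul_sum, Finset.sum_sub_distrib]
    simp
  have h2 := LinearMap.finrank_range_add_finrank_ker bd
  rw [Module.finrank_fintype_fun_eq_card] at h2
  have h3 := LinearMap.finrank_range_add_finrank_ker co
  rw [Module.finrank_fintype_fun_eq_card] at h3
  -- Constant potentials have zero difference across every edge; an edge supplies a face, so they
  -- are not all zero.
  have h4 : 1 ≤ Module.finrank ℂ (LinearMap.ker co) := by
    have : Nontrivial (LinearMap.ker co) := by
      refine ⟨⟨⟨fun _ => 1, ?_⟩, 0, ?_⟩⟩
      · simp only [LinearMap.mem_ker]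
        ext e
        simp [co]
      · intro h0
        have := congrFun (congrArg Subtype.val h0) (l e₀)
        simp at this
    exact Module.finrank_pos
  have h5 : Module.finrank ℂ (LinearMap.ker bd) ≤ Module.finrank ℂ (LinearMap.range co) := by
    refine Submodule.finrank_mono ?_
    intro z hz
    have hcyc : ∀ g : V → ℂ, ∑ e, z e * (g (t e) - g (s e)) = 0 := by
      intro g
      have hz' : ∀ v, ∑ e, z e * ((if t e = v then 1 else 0) - (if s e = v then 1 else 0)) = 0 :=
        fun v => congrFun (LinearMap.mem_ker.1 hz) v
      have : ∑ e, z e * (g (t e) - g (s e)) = ∑ v, g v *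
          ∑ e, z e * ((if t e = v then 1 else 0) - (if s e = v then 1 else 0)) := by
        simp_rw [Finset.mul_sum]
        rw [Finset.sum_comm]
        refine Finset.sum_congr rfl fun e _ => ?_
        simp only [mul_left_comm _ (z e), ← Finset.mul_sum]
        simp [mul_sub, Finset.sum_sub_distrib]
      rw [this]
      simp [hz']
    obtain ⟨w, hw⟩ := h z hcyc
    exact ⟨w, funext fun e => (hw e).symm⟩
  omega

/-! ### Thin triangles beside segments and sectors at a point. -/

open Filter Topology

/-- The open isosceles triangle with base from `a` to `b`, on the left of the base, of height
proportional to `ε`. -/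
def leftTriangle (ε : ℝ) (a b : ℂ) : Set ℂ :=
  (fun ζ : ℂ => a + ζ * (b - a)) ''
    {ζ : ℂ | 0 < ζ.im ∧ ζ.im < ε * ζ.re ∧ ζ.im < ε * (1 - ζ.re)}

/-- A point of `leftTriangle ε a b`. -/
noncomputable def leftPoint (ε : ℝ) (a b : ℂ) : ℂ := a + (1 / 2 + ε / 4 * Complex.I) * (b - a)

theorem isPathConnected_leftTriangle {ε : ℝ} (hε : 0 < ε) (a b : ℂ) :
    IsPathConnected (leftTriangle ε a b) := by
  refine IsPathConnected.image (Convex.isPathConnected ?_ ⟨1 / 2 + ε / 4 * Complex.I, ?_⟩)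
    (by fun_prop)
  · rintro x ⟨hx1, hx2, hx3⟩ y ⟨hy1, hy2, hy3⟩ s t hs ht hst
    obtain rfl : t = 1 - s := by linarith
    simp only [Set.mem_ofPred_eq, Complex.add_im, Complex.add_re, Complex.real_smul, Complex.mul_im,
      Complex.mul_re, Complex.ofReal_re, Complex.ofReal_im, zero_mul, sub_zero, add_zero]
    rcases hs.eq_or_lt with rfl | hs'
    · simpa using ⟨hy1, hy2, hy3⟩
    · refine ⟨?_, ?_, ?_⟩
      · nlinarith [mul_nonneg ht hy1.le, mul_pos hs' hx1]
      · nlinarith [mul_nonneg ht (sub_nonneg.2 hy2.le), mul_pos hs' (sub_pos.2 hx2)]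
      · nlinarith [mul_nonneg ht (sub_nonneg.2 hy3.le), mul_pos hs' (sub_pos.2 hx3)]
  · simp
    constructor <;> [skip; constructor] <;> linarith

theorem leftPoint_mem_leftTriangle {ε δ : ℝ} (hε : 0 < ε) (h : ε ≤ δ) (a b : ℂ) :
    leftPoint ε a b ∈ leftTriangle δ a b := by
  refine ⟨1 / 2 + ε / 4 * Complex.I, ?_, rfl⟩
  simp
  constructor <;> [skip; constructor] <;> linarith

/-- This is the separation of a segment from a thin triangle in coordinates where the base is the
interval from `0` to `1`; `x₀ + t * x₁` and `y₀ + t * y₁` are the coordinates of a moving point of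
the segment. It either meets the axis outside the open base, lies in the axis, or stays away from
the axis. -/
theorem exists_thin_of_affine (x₀ x₁ y₀ y₁ : ℝ)
    (h : ∀ t, 0 ≤ t → t ≤ 1 → y₀ + t * y₁ = 0 → 0 < x₀ + t * x₁ → ¬ x₀ + t * x₁ < 1) :
    ∃ δ > 0, ∀ ε, 0 < ε → ε < δ → ∀ t, 0 ≤ t → t ≤ 1 → 0 < y₀ + t * y₁ →
      y₀ + t * y₁ < ε * (x₀ + t * x₁) → ¬ y₀ + t * y₁ < ε * (1 - (x₀ + t * x₁)) := by
  by_cases hz : ∃ t, 0 ≤ t ∧ t ≤ 1 ∧ y₀ + t * y₁ = 0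
  · obtain ⟨s, hs0, hs1, hs⟩ := hz
    have hx := h s hs0 hs1 hs
    by_cases hy : y₁ = 0
    · refine ⟨1, one_pos, fun ε _ _ t _ _ h0 => ?_⟩
      subst hy
      simp only [mul_zero, add_zero] at hs h0
      linarith
    · have hypos := abs_pos.2 hy
      have hxn := abs_nonneg x₁
      -- The segment leaves the axis with slope at least `|y₁| / |x₁|`, so a triangle with a flatter
      -- angle cannot reach it.
      refine ⟨|y₁| / (|x₁| + 1), by positivity, fun ε hε hεδ t _ _ h0 h1 h2 => ?_⟩
      rw [lt_div_iff₀ (by positivity)] at hεδ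
      have e1 : y₀ + t * y₁ = y₁ * (t - s) := by linarith
      have e2 : y₁ * (t - s) = |y₁| * |t - s| := by
        rw [← abs_mul, abs_of_pos (by linarith)]
      have ht : 0 ≤ |t - s| := abs_nonneg _
      have e3 : |x₁ * (t - s)| = |x₁| * |t - s| := abs_mul _ _
      have e4 := le_abs_self (x₁ * (t - s))
      have e5 := neg_abs_le (x₁ * (t - s))
      have e6 := mul_le_mul_of_nonneg_right hεδ.le ht
      rcases le_or_gt (x₀ + s * x₁) 0 with h3 | h3
      · nlinarith [mul_nonneg hε.le ht, mul_nonneg hε.le (sub_nonneg.2 e4),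
          mul_nonneg hε.le (neg_nonneg.2 h3)]
      · have h4 := not_lt.1 (hx h3)
        nlinarith [mul_nonneg hε.le ht, mul_nonneg hε.le (sub_nonneg.2 e5),
          mul_nonneg hε.le (sub_nonneg.2 h4)]
  · push Not at hz
    rcases lt_or_ge y₀ 0 with h0 | h0
    · have h1 : y₀ + y₁ < 0 := by
        by_contra hc
        have : 0 < y₁ := by linarith
        refine hz (-y₀ / y₁) (div_nonneg (by linarith) this.le) ?_ (by field_simp; ring)
        rw [div_le_one this]; linarith
      refine ⟨1, one_pos, fun ε _ _ t ht0 ht1 h2 => ?_⟩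
      nlinarith
    · have h0' : 0 < y₀ := lt_of_le_of_ne h0 fun h => hz 0 le_rfl zero_le_one (by simp [← h])
      have h1 : 0 < y₀ + y₁ := by
        by_contra hc
        have : 0 < -y₁ := by linarith
        have hy : y₁ ≠ 0 := by linarith
        refine hz (y₀ / -y₁) (div_nonneg (by linarith) this.le) ?_ (by field_simp; ring)
        rw [div_le_one this]; linarith
      refine ⟨min y₀ (y₀ + y₁), lt_min h0' h1, fun ε hε hεδ t ht0 ht1 _ h2 h3 => ?_⟩
      have h4 := min_le_left y₀ (y₀ + y₁)
      have h5 := min_le_right y₀ (y₀ + y₁)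
      nlinarith [mul_nonneg (sub_nonneg.2 ht1) (sub_nonneg.2 h4), mul_nonneg ht0 (sub_nonneg.2 h5)]

theorem eventually_disjoint_leftTriangle {a b : ℂ} (hab : a ≠ b) (c d : ℂ)
    (h : ∀ x ∈ segment ℝ c d, x ∉ openSegment ℝ a b) :
    ∀ᶠ ε in 𝓝[>] (0 : ℝ), Disjoint (leftTriangle ε a b) (segment ℝ c d) := by
  have hba : b - a ≠ 0 := sub_ne_zero.2 hab.symm
  obtain ⟨δ, hδ, H⟩ := exists_thin_of_affine ((c - a) / (b - a)).re ((d - c) / (b - a)).re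
    ((c - a) / (b - a)).im ((d - c) / (b - a)).im (by
      intro t ht0 ht1 hy hx0 hx1
      refine h (c + (t : ℂ) * (d - c)) ?_ ?_
      · rw [segment_eq_image']
        exact ⟨t, ⟨ht0, ht1⟩, by simp⟩
      · rw [openSegment_eq_image']
        refine ⟨_, ⟨hx0, hx1⟩, ?_⟩
        have : (((((c - a) / (b - a)).re + t * ((d - c) / (b - a)).re : ℝ)) : ℂ) =
            (c - a) / (b - a) + t * ((d - c) / (b - a)) := by
          apply Complex.ext
          · simp
          · simpa using hy.symm
        simp only [Complex.real_smul]
        rw [this]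
        field_simp
        ring)
  filter_upwards [Ioo_mem_nhdsGT hδ] with ε hε
  rw [Set.disjoint_left]
  rintro _ ⟨ζ, ⟨h1, h2, h3⟩, rfl⟩ hx
  rw [segment_eq_image'] at hx
  obtain ⟨t, ⟨ht0, ht1⟩, ht⟩ := hx
  have hζ : ζ = (c - a) / (b - a) + t * ((d - c) / (b - a)) := by
    simp only [Complex.real_smul] at ht
    field_simp
    linear_combination -ht
  have e1 : ζ.re = ((c - a) / (b - a)).re + t * ((d - c) / (b - a)).re := by rw [hζ]; simp
  have e2 : ζ.im = ((c - a) / (b - a)).im + t * ((d - c) / (b - a)).im := by rw [hζ]; simp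
  rw [e1, e2] at h2 h3
  rw [e2] at h1
  exact H ε hε.1 hε.2 t ht0 ht1 h1 h2 h3

theorem disjoint_leftTriangle_self {a b : ℂ} (hab : a ≠ b) :
    ∀ ε, Disjoint (leftTriangle ε a b) (segment ℝ a b) := by
  have hba : b - a ≠ 0 := sub_ne_zero.2 hab.symm
  intro ε
  rw [Set.disjoint_left]
  rintro _ ⟨ζ, ⟨h1, h2, h3⟩, rfl⟩ hx
  rw [segment_eq_image'] at hx
  obtain ⟨t, ⟨ht0, ht1⟩, ht⟩ := hx
  have hζ : ζ = t := by
    simp only [Complex.real_smul] at ht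
    have : (ζ - t) * (b - a) = 0 := by linear_combination -ht
    exact sub_eq_zero.1 ((mul_eq_zero.1 this).resolve_right hba)
  rw [hζ] at h1
  simp at h1

open Real in
theorem exp_mem_thin {ε ρ θ : ℝ} (hε : 0 < ε) (hρ : 0 < ρ) (hρε : ρ * (1 + ε) < ε)
    (h1 : 0 < sin θ) (h2 : sin θ < ε * cos θ) :
    0 < ρ * sin θ ∧ ρ * sin θ < ε * (ρ * cos θ) ∧ ρ * sin θ < ε * (1 - ρ * cos θ) := by
  refine ⟨by positivity, by nlinarith, ?_⟩
  have := sin_le_one θ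
  have := cos_le_one θ
  nlinarith [mul_nonneg hρ.le (sub_nonneg.2 (sin_le_one θ)),
    mul_nonneg (mul_nonneg hε.le hρ.le) (sub_nonneg.2 (cos_le_one θ))]

open Real Complex in
/-- If the sector at `v` from direction `u₁` counterclockwise to direction `u₂` avoids `K` near `v`,
then the left side of `u₁` and the right side of `u₂` are connected in the complement of `K`. -/
theorem joinedIn_of_sector {K : Set ℂ} {v u₁ u₂ : ℂ} {α r ε c : ℝ} (hα : 0 < α) (hr : 0 < r)
    (hε : 0 < ε) (hc : 0 < c) (hu : u₂ = c * u₁ * exp (α * I))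
    (hfree : ∀ ρ θ : ℝ, 0 < ρ → ρ < r → 0 < θ → θ < α → v + ρ * u₁ * exp (θ * I) ∉ K)
    (h₁ : Disjoint (leftTriangle ε v (v + u₁)) K) (h₂ : Disjoint (leftTriangle ε (v + u₂) v) K) :
    JoinedIn Kᶜ (leftPoint ε v (v + u₁)) (leftPoint ε (v + u₂) v) := by
  obtain ⟨θ, ⟨hθ0, hθα⟩, hs0, hsε⟩ :
      ∃ θ : ℝ, (0 < θ ∧ θ < α) ∧ 0 < Real.sin θ ∧ Real.sin θ < ε * Real.cos θ := by
    have e1 : ∀ᶠ θ : ℝ in 𝓝[>] 0, Real.sin θ < ε * Real.cos θ := by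
      refine nhdsWithin_le_nhds (ContinuousAt.eventually_lt ?_ ?_ ?_)
      · fun_prop
      · fun_prop
      · simpa using hε
    have e2 : ∀ᶠ θ : ℝ in 𝓝[>] 0, θ ∈ Set.Ioo 0 α := Ioo_mem_nhdsGT hα
    have e3 : ∀ᶠ θ : ℝ in 𝓝[>] 0, θ ∈ Set.Ioo 0 π := Ioo_mem_nhdsGT pi_pos
    obtain ⟨θ, h1, h2, h3⟩ := (e1.and (e2.and e3)).exists
    exact ⟨θ, h2, Real.sin_pos_of_mem_Ioo h3, h1⟩
  obtain ⟨ρ, hρ0, hρr, hρ1, hρ2⟩ :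
      ∃ ρ : ℝ, 0 < ρ ∧ ρ < r ∧ ρ * (1 + ε) < ε ∧ ρ / c * (1 + ε) < ε := by
    have e1 : ∀ᶠ ρ : ℝ in 𝓝[>] 0, ρ * (1 + ε) < ε := by
      refine nhdsWithin_le_nhds (ContinuousAt.eventually_lt ?_ ?_ ?_)
      · fun_prop
      · fun_prop
      · simpa using hε
    have e2 : ∀ᶠ ρ : ℝ in 𝓝[>] 0, ρ / c * (1 + ε) < ε := by
      refine nhdsWithin_le_nhds (ContinuousAt.eventually_lt ?_ ?_ ?_)
      · fun_prop
      · fun_prop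
      · simpa using hε
    have e3 : ∀ᶠ ρ : ℝ in 𝓝[>] 0, ρ ∈ Set.Ioo 0 r := Ioo_mem_nhdsGT hr
    obtain ⟨ρ, h1, h2, h3⟩ := (e1.and (e2.and e3)).exists
    exact ⟨ρ, h3.1, h3.2, h1, h2⟩
  have j1 : JoinedIn Kᶜ (leftPoint ε v (v + u₁)) (v + ρ * u₁ * exp (θ * I)) := by
    refine ((isPathConnected_leftTriangle hε v (v + u₁)).joinedIn _
      (leftPoint_mem_leftTriangle hε le_rfl _ _) _ ?_).mono h₁.subset_compl_right
    refine ⟨ρ * exp (θ * I), ?_, by ring⟩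
    simpa [exp_ofReal_mul_I_re, exp_ofReal_mul_I_im] using exp_mem_thin hε hρ0 hρ1 hs0 hsε
  have j2 : JoinedIn Kᶜ (leftPoint ε (v + u₂) v) (v + ρ * u₁ * exp ((α - θ : ℝ) * I)) := by
    refine ((isPathConnected_leftTriangle hε (v + u₂) v).joinedIn _
      (leftPoint_mem_leftTriangle hε le_rfl _ _) _ ?_).mono h₂.subset_compl_right
    -- The base of this triangle ends at `v`, which has coordinate `1`; hence the subtraction, and
    -- the rotation by `-θ`.
    refine ⟨1 - (ρ / c : ℝ) * exp ((-θ : ℝ) * I), ?_, ?_⟩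
    · have := exp_mem_thin hε (div_pos hρ0 hc) hρ2 hs0 hsε
      simp only [Set.mem_ofPred_eq, sub_im, one_im, sub_re, one_re, re_ofReal_mul, im_ofReal_mul,
        exp_ofReal_mul_I_re, exp_ofReal_mul_I_im, Real.sin_neg, Real.cos_neg]
      refine ⟨by linarith [this.1], by linarith [this.2.2], by linarith [this.2.1]⟩
    · have hexp : exp ((α - θ : ℝ) * I) = exp (α * I) * exp ((-θ : ℝ) * I) := by
        rw [← Complex.exp_add]; push_cast; ring_nf
      have hc' : (c : ℂ) ≠ 0 := by exact_mod_cast hc.ne'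
      rw [hexp, hu]
      push_cast
      field_simp
      ring
  have j3 : JoinedIn Kᶜ (v + ρ * u₁ * exp (θ * I)) (v + ρ * u₁ * exp ((α - θ : ℝ) * I)) := by
    have : IsPathConnected ((fun φ : ℝ => v + ρ * u₁ * exp (φ * I)) '' Set.Ioo 0 α) :=
      ((convex_Ioo 0 α).isPathConnected ⟨θ, hθ0, hθα⟩).image (by fun_prop)
    refine (this.joinedIn _ ⟨θ, ⟨hθ0, hθα⟩, rfl⟩ _
      ⟨α - θ, ⟨by linarith, by linarith⟩, rfl⟩).mono ?_
    rintro _ ⟨φ, ⟨h1, h2⟩, rfl⟩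
    exact hfree ρ φ hρ0 hρr h1 h2
  exact j1.trans (j3.trans j2.symm)

/-! ### The logarithm subtended by a segment. -/

-- A nonpositive real quotient would put `a` and `b` on opposite sides of `P`, and `P` would be a
-- convex combination of them. So the principal logarithm is smooth off the segment.
open Complex in
theorem div_mem_slitPlane_of_notMem_segment {a b P : ℂ} (h : P ∉ segment ℝ a b) :
    (b - P) / (a - P) ∈ slitPlane := by
  rw [mem_slitPlane_iff_not_le_zero]
  intro hle
  refine h ?_
  have haP : a - P ≠ 0 := fun h0 => h (by rw [← sub_eq_zero.1 h0]; exact left_mem_segment _ _ _)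
  rw [Complex.le_def] at hle
  simp only [zero_re, zero_im] at hle
  obtain ⟨h1, h2⟩ := hle
  set r := -((b - P) / (a - P)).re with hr
  have hr0 : 0 ≤ r := by linarith
  have e : (b - P) / (a - P) = ((-r : ℝ) : ℂ) := by
    apply Complex.ext
    · simp [hr]
    · simp [h2]
  rw [div_eq_iff haP] at e
  refine ⟨r / (1 + r), 1 / (1 + r), by positivity, by positivity, by field_simp; ring, ?_⟩
  have h1r : (1 + r : ℂ) ≠ 0 := by exact_mod_cast (by positivity : (1 + r : ℝ) ≠ 0)
  simp only [real_smul]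
  push_cast at e ⊢
  field_simp
  linear_combination e

open Complex in
theorem hasDerivAt_log_div {a b P : ℂ} (h : P ∉ segment ℝ a b) :
    HasDerivAt (fun P => log ((b - P) / (a - P))) ((a - P)⁻¹ - (b - P)⁻¹) P := by
  have haP : a - P ≠ 0 := fun h0 => h (by rw [← sub_eq_zero.1 h0]; exact left_mem_segment _ _ _)
  have hbP : b - P ≠ 0 := fun h0 => h (by rw [← sub_eq_zero.1 h0]; exact right_mem_segment _ _ _)
  have h1 : HasDerivAt (fun P => b - P) (-1) P := (hasDerivAt_id P).const_sub b
  have h2 : HasDerivAt (fun P => a - P) (-1) P := (hasDerivAt_id P).const_sub a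
  have h3 : HasDerivAt (fun P => (b - P) / (a - P)) _ P := h1.div h2 haP
  convert h3.clog (div_mem_slitPlane_of_notMem_segment h) using 1
  field_simp
  ring

open Complex Real in
/-- The logarithm subtended by a segment jumps by `2πi` across its midpoint. -/
theorem tendsto_log_div_sub {a b : ℂ} (hab : a ≠ b) :
    Tendsto (fun ε : ℝ =>
      log ((b - leftPoint ε a b) / (a - leftPoint ε a b)) -
      log ((b - leftPoint ε b a) / (a - leftPoint ε b a))) (𝓝[>] 0) (𝓝 (2 * π * I)) := by
  have hba : b - a ≠ 0 := sub_ne_zero.2 hab.symm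
  have hne : ∀ ε : ℝ, (1 / 2 + ε / 4 * I : ℂ) ≠ 0 := fun ε h => by
    have := congrArg re h; simp at this
  have hne' : ∀ ε : ℝ, (1 / 2 - ε / 4 * I : ℂ) ≠ 0 := fun ε h => by
    have := congrArg re h; simp at this
  have e1 : ∀ ε : ℝ, (b - leftPoint ε a b) / (a - leftPoint ε a b) =
      -((1 / 2 - ε / 4 * I) / (1 / 2 + ε / 4 * I)) := by
    intro ε
    have : a - leftPoint ε a b = -((1 / 2 + ε / 4 * I) * (b - a)) := by unfold leftPoint; ring
    rw [this, div_neg, neg_inj, div_eq_div_iff (mul_ne_zero (hne ε) hba) (hne ε)]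
    unfold leftPoint
    ring
  have e2 : ∀ ε : ℝ, (b - leftPoint ε b a) / (a - leftPoint ε b a) =
      -((1 / 2 + ε / 4 * I) / (1 / 2 - ε / 4 * I)) := by
    intro ε
    have : a - leftPoint ε b a = -((1 / 2 - ε / 4 * I) * (b - a)) := by unfold leftPoint; ring
    rw [this, div_neg, neg_inj, div_eq_div_iff (mul_ne_zero (hne' ε) hba) (hne' ε)]
    unfold leftPoint
    ring
  simp only [e1, e2]
  -- The quotients approach `-1` from above and from below the branch cut, so the logarithms tend to
  -- `πi` and `-πi`.
  have im1 : ∀ ε : ℝ, 0 < ε → 0 < (-((1 / 2 - ε / 4 * I) / (1 / 2 + ε / 4 * I) : ℂ)).im := by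
    intro ε hε
    have : (-((1 / 2 - ε / 4 * I) / (1 / 2 + ε / 4 * I) : ℂ)) =
        (((ε ^ 2 - 4) / (ε ^ 2 + 4) : ℝ) : ℂ) + ((4 * ε) / (ε ^ 2 + 4) : ℝ) * I := by
      have h0 : ((ε ^ 2 + 4 : ℝ) : ℂ) ≠ 0 := ofReal_ne_zero.2 (by positivity)
      push_cast at h0
      rw [← neg_div, div_eq_iff (hne ε)]
      push_cast
      field_simp
      linear_combination (-8 * ε ^ 2) * I_sq
    have h1 : 0 < (4 * ε) / (ε ^ 2 + 4) := by positivity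
    rw [this, add_im, ofReal_im, im_ofReal_mul, I_im]
    linarith
  have im2 : ∀ ε : ℝ, 0 < ε → (-((1 / 2 + ε / 4 * I) / (1 / 2 - ε / 4 * I) : ℂ)).im < 0 := by
    intro ε hε
    have h := im1 ε hε
    have : (-((1 / 2 + ε / 4 * I) / (1 / 2 - ε / 4 * I) : ℂ)) =
        (starRingEnd ℂ) (-((1 / 2 - ε / 4 * I) / (1 / 2 + ε / 4 * I) : ℂ)) := by
      simp [map_div₀, map_ofNat, ← sub_eq_add_neg]
    rw [this, conj_im]
    linarith
  have l1 : Tendsto (fun ε : ℝ => (-((1 / 2 - ε / 4 * I) / (1 / 2 + ε / 4 * I) : ℂ))) (𝓝[>] 0)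
      (𝓝[{z : ℂ | 0 ≤ z.im}] (-1)) := by
    refine tendsto_nhdsWithin_iff.2 ⟨?_, ?_⟩
    · refine tendsto_nhdsWithin_of_tendsto_nhds ?_
      have : ContinuousAt (fun ε : ℝ => (-((1 / 2 - ε / 4 * I) / (1 / 2 + ε / 4 * I) : ℂ))) 0 := by
        refine ContinuousAt.neg (ContinuousAt.div (by fun_prop) (by fun_prop) (hne 0))
      convert this.tendsto using 2
      norm_num
    · filter_upwards [self_mem_nhdsWithin] with ε hε
      exact (im1 ε hε).le
  have l2 : Tendsto (fun ε : ℝ => (-((1 / 2 + ε / 4 * I) / (1 / 2 - ε / 4 * I) : ℂ))) (𝓝[>] 0)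
      (𝓝[{z : ℂ | z.im < 0}] (-1)) := by
    refine tendsto_nhdsWithin_iff.2 ⟨?_, ?_⟩
    · refine tendsto_nhdsWithin_of_tendsto_nhds ?_
      have : ContinuousAt (fun ε : ℝ => (-((1 / 2 + ε / 4 * I) / (1 / 2 - ε / 4 * I) : ℂ))) 0 := by
        refine ContinuousAt.neg (ContinuousAt.div (by fun_prop) (by fun_prop) (hne' 0))
      convert this.tendsto using 2
      norm_num
    · filter_upwards [self_mem_nhdsWithin] with ε hε
      exact im2 ε hε
  have t1 := (tendsto_log_nhdsWithin_im_nonneg_of_re_neg_of_im_zero (z := -1) (by simp)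
    (by simp)).comp l1
  have t2 := (tendsto_log_nhdsWithin_im_neg_of_re_neg_of_im_zero (z := -1) (by simp)
    (by simp)).comp l2
  convert t1.sub t2 using 2
  simp
  ring

/-! ### Polygonal drawings and their local structure. -/

/-- A plane multigraph with polygonal edges in the complex plane: the edge `e` is the polygonal path
through `pt e 0, …, pt e (len e)`. -/
structure ComplexDrawing (E : Type*) where
  verts : Finset ℂ
  len : E → ℕ
  pt : E → ℕ → ℂ
  len_pos : ∀ e, 0 < len e
  pt_ne : ∀ e i, i < len e → pt e i ≠ pt e (i + 1)
  simple : ∀ e i j, i < j → j < len e → ∀ x ∈ segment ℝ (pt e i) (pt e (i + 1)),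
    x ∈ segment ℝ (pt e j) (pt e (j + 1)) →
      (i + 1 = j ∧ x = pt e j) ∨ (i = 0 ∧ j + 1 = len e ∧ x = pt e 0 ∧ x = pt e (len e))
  source_mem : ∀ e, pt e 0 ∈ verts
  target_mem : ∀ e, pt e (len e) ∈ verts
  vertex_on_edge : ∀ e i, i < len e → ∀ v ∈ verts, v ∈ segment ℝ (pt e i) (pt e (i + 1)) →
    v = pt e 0 ∨ v = pt e (len e)
  edge_inter : ∀ e f i j, e ≠ f → i < len e → j < len f →
    ∀ x ∈ segment ℝ (pt e i) (pt e (i + 1)), x ∈ segment ℝ (pt f j) (pt f (j + 1)) → x ∈ verts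

namespace ComplexDrawing

variable {E : Type*} (G : ComplexDrawing E)

/-- The `i`-th segment of the edge `e`. -/
def seg (e : E) (i : ℕ) : Set ℂ := segment ℝ (G.pt e i) (G.pt e (i + 1))

/-- The union of all edges. -/
def carrier : Set ℂ := ⋃ e, ⋃ i ∈ Finset.range (G.len e), G.seg e i

theorem mem_carrier {x : ℂ} : x ∈ G.carrier ↔ ∃ e i, i < G.len e ∧ x ∈ G.seg e i := by
  simp [carrier]

theorem pt_mem_seg_left (e : E) (i : ℕ) : G.pt e i ∈ G.seg e i := left_mem_segment _ _ _

theorem pt_mem_seg_right (e : E) (i : ℕ) : G.pt e (i + 1) ∈ G.seg e i := right_mem_segment _ _ _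

/-- A vertex on a segment is the initial vertex or the final vertex of the edge. -/
theorem vertex_mem_seg {e : E} {i : ℕ} (hi : i < G.len e) {v : ℂ} (hv : v ∈ G.verts)
    (h : v ∈ G.seg e i) : (i = 0 ∧ v = G.pt e 0) ∨ (i + 1 = G.len e ∧ v = G.pt e (G.len e)) := by
  have hne := G.pt_ne e i hi
  rcases G.vertex_on_edge e i hi v hv h with rfl | rfl
  · rcases Nat.eq_zero_or_pos i with rfl | hpos
    · exact Or.inl ⟨rfl, rfl⟩
    · obtain ⟨j, rfl⟩ : ∃ j, i = j + 1 := ⟨i - 1, by omega⟩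
      rcases G.simple e 0 (j + 1) hpos hi _ (G.pt_mem_seg_left e 0) h with h1 | h1
      · exfalso
        obtain ⟨h1, h2⟩ := h1
        obtain rfl : j = 0 := by omega
        exact G.pt_ne e 0 (G.len_pos e) h2
      · exact Or.inr ⟨h1.2.1, h1.2.2.2⟩
  · obtain ⟨k, hk⟩ : ∃ k, G.len e = k + 1 := ⟨G.len e - 1, by have := G.len_pos e; omega⟩
    rcases eq_or_ne i k with rfl | hik
    · exact Or.inr ⟨hk.symm, rfl⟩
    · have h2 := G.pt_mem_seg_right e k
      rw [← hk] at h2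
      rcases G.simple e i k (by omega) (by omega) _ h h2 with h1 | h1
      · exfalso
        refine G.pt_ne e k (by omega) ?_
        rw [← h1.2, hk]
      · exact Or.inl ⟨h1.1, h1.2.2.1⟩

/-- A bend lies only on the two segments that it joins. -/
theorem bend_mem_seg {e f : E} {i j : ℕ} (hi : i + 1 < G.len e) (hj : j < G.len f)
    (h : G.pt e (i + 1) ∈ G.seg f j) : f = e ∧ (j = i ∨ j = i + 1) := by
  have hne := G.pt_ne e i (by omega)
  have hne' := G.pt_ne e (i + 1) hi
  by_cases hfe : f = e
  · subst hfe
    refine ⟨rfl, ?_⟩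
    by_contra! hc
    rcases lt_or_ge j i with hlt | hge
    · rcases G.simple f j i hlt (by omega) _ h (G.pt_mem_seg_right f i) with h1 | h1
      · exact hne h1.2.symm
      · omega
    · rcases G.simple f (i + 1) j (by omega) hj _ (G.pt_mem_seg_left f (i + 1)) h with h1 | h1
      · exact hne' (by rw [h1.2, h1.1])
      · omega
  · exfalso
    have hv := G.edge_inter e f (i + 1) j (Ne.symm hfe) hi hj _ (G.pt_mem_seg_left e (i + 1)) h
    rcases G.vertex_mem_seg hi hv (G.pt_mem_seg_left e (i + 1)) with h1 | h1
    · omega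
    · refine hne' ?_
      rw [h1.2, h1.1]

/-- Distinct segments meet only at endpoints. -/
theorem eq_or_eq_of_mem_seg {e f : E} {i j : ℕ} (hne : ¬ (e = f ∧ i = j)) (hi : i < G.len e)
    (hj : j < G.len f) {x : ℂ} (hx : x ∈ G.seg e i) (hx' : x ∈ G.seg f j) :
    x = G.pt e i ∨ x = G.pt e (i + 1) := by
  by_cases hef : e = f
  · subst hef
    rcases lt_trichotomy i j with h | h | h
    · rcases G.simple e i j h hj x hx hx' with h1 | h1
      · exact Or.inr (by rw [h1.1]; exact h1.2)
      · exact Or.inl (by rw [h1.1]; exact h1.2.2.1)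
    · exact absurd ⟨rfl, h⟩ hne
    · rcases G.simple e j i h hi x hx' hx with h1 | h1
      · exact Or.inl h1.2
      · exact Or.inr (by rw [h1.2.1]; exact h1.2.2.2)
  · have hv := G.edge_inter e f i j hef hi hj x hx hx'
    rcases G.vertex_mem_seg hi hv hx with ⟨rfl, h⟩ | ⟨h1, h2⟩
    · exact Or.inl h
    · exact Or.inr (by rw [h1]; exact h2)

theorem notMem_openSegment {e f : E} {i j : ℕ} (hne : ¬ (e = f ∧ i = j)) (hi : i < G.len e)
    (hj : j < G.len f) {x : ℂ} (hx : x ∈ G.seg f j) :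
    x ∉ openSegment ℝ (G.pt e i) (G.pt e (i + 1)) := by
  intro hx'
  have h := G.pt_ne e i hi
  rcases G.eq_or_eq_of_mem_seg hne hi hj (openSegment_subset_segment _ _ _ hx') hx with rfl | rfl
  · exact h (left_mem_openSegment_iff.1 hx')
  · exact h (right_mem_openSegment_iff.1 hx')

/-- The triangles of height `ε` at both sides of all segments avoid the drawing. -/
def IsThin (ε : ℝ) : Prop := ∀ e i, i < G.len e →
  Disjoint (leftTriangle ε (G.pt e i) (G.pt e (i + 1))) G.carrier ∧
    Disjoint (leftTriangle ε (G.pt e (i + 1)) (G.pt e i)) G.carrier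

theorem eventually_isThin [Finite E] : ∀ᶠ ε in 𝓝[>] (0 : ℝ), G.IsThin ε := by
  have key : ∀ᶠ ε in 𝓝[>] (0 : ℝ), ∀ e, ∀ i ∈ Finset.range (G.len e), ∀ f,
      ∀ j ∈ Finset.range (G.len f),
      Disjoint (leftTriangle ε (G.pt e i) (G.pt e (i + 1))) (G.seg f j) ∧
      Disjoint (leftTriangle ε (G.pt e (i + 1)) (G.pt e i)) (G.seg f j) := by
    refine eventually_all.2 fun e => (eventually_all_finset _).2 fun i hi =>
      eventually_all.2 fun f => (eventually_all_finset _).2 fun j hj => ?_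
    rw [Finset.mem_range] at hi hj
    have hp := G.pt_ne e i hi
    by_cases h : e = f ∧ i = j
    · obtain ⟨rfl, rfl⟩ := h
      refine Eventually.of_forall fun ε => ⟨disjoint_leftTriangle_self hp ε, ?_⟩
      rw [seg, segment_symm]
      exact disjoint_leftTriangle_self hp.symm ε
    · refine (eventually_disjoint_leftTriangle hp _ _
        fun x hx => G.notMem_openSegment h hi hj hx).and
        (eventually_disjoint_leftTriangle hp.symm _ _ fun x hx => ?_)
      rw [openSegment_symm]
      exact G.notMem_openSegment h hi hj hx
  filter_upwards [key] with ε hε e i hi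
  simp only [carrier, Set.disjoint_iUnion_right]
  exact ⟨fun f j hj => (hε e i (Finset.mem_range.2 hi) f j hj).1,
    fun f j hj => (hε e i (Finset.mem_range.2 hi) f j hj).2⟩

theorem isClosed_seg (e : E) (i : ℕ) : IsClosed (G.seg e i) := by
  rw [seg, segment_eq_image']
  exact (isCompact_Icc.image (by fun_prop)).isClosed

theorem isClosed_carrier [Finite E] : IsClosed G.carrier :=
  isClosed_iUnion_of_finite fun e => isClosed_biUnion_finset fun i _ => G.isClosed_seg e i

/-- `u` is the vector from `v` to the other endpoint of a segment starting at `v`. -/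
def IsDir (v u : ℂ) : Prop := ∃ e i, i < G.len e ∧
  ((v = G.pt e i ∧ u = G.pt e (i + 1) - v) ∨ (v = G.pt e (i + 1) ∧ u = G.pt e i - v))

variable {G} in
theorem IsDir.ne_zero {v u : ℂ} (h : G.IsDir v u) : u ≠ 0 := by
  obtain ⟨e, i, hi, ⟨rfl, rfl⟩ | ⟨rfl, rfl⟩⟩ := h
  · exact sub_ne_zero.2 (G.pt_ne e i hi).symm
  · exact sub_ne_zero.2 (G.pt_ne e i hi)

variable {G} in
theorem IsDir.disjoint {v u : ℂ} (h : G.IsDir v u) {ε : ℝ} (hε : G.IsThin ε) :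
    Disjoint (leftTriangle ε v (v + u)) G.carrier ∧
      Disjoint (leftTriangle ε (v + u) v) G.carrier := by
  obtain ⟨e, i, hi, ⟨rfl, rfl⟩ | ⟨rfl, rfl⟩⟩ := h
  · rw [add_sub_cancel]
    exact hε e i hi
  · rw [add_sub_cancel]
    exact (hε e i hi).symm

/-- Segments that miss `v` are finitely many closed sets and stay away from it. By `hv`, every other
segment has `v` as an endpoint, so near `v` the drawing consists of initial pieces of rays. -/
theorem exists_radius [Finite E] (v : ℂ)
    (hv : ∀ e i, i < G.len e → v ∈ G.seg e i → v = G.pt e i ∨ v = G.pt e (i + 1)) :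
    ∃ r > 0, ∀ x ∈ G.carrier, dist x v < r → x ≠ v →
      ∃ u, G.IsDir v u ∧ ∃ t : ℝ, 0 < t ∧ x = v + t * u := by
  have key : ∀ᶠ x in 𝓝 v, ∀ e, ∀ i ∈ Finset.range (G.len e), x ∈ G.seg e i → x ≠ v →
      ∃ u, G.IsDir v u ∧ ∃ t : ℝ, 0 < t ∧ x = v + t * u := by
    refine eventually_all.2 fun e => (eventually_all_finset _).2 fun i hi => ?_
    rw [Finset.mem_range] at hi
    by_cases h : v ∈ G.seg e i
    · refine Eventually.of_forall fun x hx hxv => ?_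
      rcases hv e i hi h with h1 | h1
      · refine ⟨_, ⟨e, i, hi, Or.inl ⟨h1, rfl⟩⟩, ?_⟩
        rw [seg, segment_eq_image'] at hx
        obtain ⟨t, ⟨ht0, ht1⟩, rfl⟩ := hx
        refine ⟨t, lt_of_le_of_ne ht0 ?_, by simp [h1]⟩
        rintro rfl
        exact hxv (by simp [h1])
      · refine ⟨_, ⟨e, i, hi, Or.inr ⟨h1, rfl⟩⟩, ?_⟩
        rw [seg, segment_symm, segment_eq_image'] at hx
        obtain ⟨t, ⟨ht0, ht1⟩, rfl⟩ := hx
        refine ⟨t, lt_of_le_of_ne ht0 ?_, by simp [h1]⟩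
        rintro rfl
        exact hxv (by simp [h1])
    · filter_upwards [(G.isClosed_seg e i).isOpen_compl.mem_nhds h] with x hx hx'
      exact absurd hx' hx
  obtain ⟨r, hr, H⟩ := Metric.eventually_nhds_iff.1 key
  refine ⟨r, hr, fun x hx hxr hxv => ?_⟩
  obtain ⟨e, i, hi, hxi⟩ := G.mem_carrier.1 hx
  exact H hxr e i (Finset.mem_range.2 hi) hxi hxv

end ComplexDrawing

-- Both sides agree modulo `2π`, and the range of `arg` leaves only two possible multiples.
open Complex Real in
theorem arg_mul_exp_cases {c θ : ℝ} {u : ℂ} (hc : 0 < c) (hu : u ≠ 0) (h0 : 0 < θ)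
    (h1 : θ < 2 * π) :
    arg (c * u * exp (θ * I)) = arg u + θ ∨ arg (c * u * exp (θ * I)) = arg u + θ - 2 * π := by
  have e : (arg (c * u * exp (θ * I)) : Angle) = ((arg u + θ : ℝ) : Angle) := by
    rw [mul_assoc, arg_real_mul _ hc, arg_mul_coe_angle hu (exp_ne_zero _), Angle.coe_add,
      exp_mul_I, ← arg_cos_add_sin_mul_I_coe_angle (θ : Angle)]
    simp
  obtain ⟨k, hk⟩ := Angle.angle_eq_iff_two_pi_dvd_sub.1 e
  have a1 := neg_pi_lt_arg u
  have a2 := arg_le_pi u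
  have b1 := neg_pi_lt_arg (c * u * exp (θ * I))
  have b2 := arg_le_pi (c * u * exp (θ * I))
  have hpi := pi_pos
  have k1 : k < 1 := by
    have : (k : ℝ) < 1 := by nlinarith
    exact_mod_cast this
  have k2 : -2 < k := by
    have : (-2 : ℝ) < k := by nlinarith
    exact_mod_cast this
  have k3 : k = 0 ∨ k = -1 := by omega
  rcases k3 with rfl | rfl
  · left; push_cast at hk; linarith
  · right; push_cast at hk; linarith

open Complex Real in
theorem eq_mul_exp_cyclicGap {u w : ℂ} (hu : u ≠ 0) :
    w = (‖w‖ / ‖u‖ : ℝ) * u * exp (cyclicGap (arg u) (arg w) * I) := by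
  have h1 : exp (cyclicGap (arg u) (arg w) * I) = exp ((arg w - arg u) * I) := by
    unfold cyclicGap
    split_ifs
    · push_cast; ring_nf
    · rw [exp_eq_exp_iff_exists_int]
      refine ⟨1, ?_⟩
      push_cast; ring
  have hn : (‖u‖ : ℂ) ≠ 0 := by exact_mod_cast norm_ne_zero_iff.2 hu
  have h2 := norm_mul_exp_arg_mul_I u
  have h3 := norm_mul_exp_arg_mul_I w
  rw [h1]
  calc w = ‖w‖ * exp (arg w * I) := h3.symm
    _ = (‖w‖ / ‖u‖ : ℝ) * (‖u‖ * exp (arg u * I)) * exp ((arg w - arg u) * I) := by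
      have : exp ((arg w - arg u) * I) * exp (arg u * I) = exp (arg w * I) := by
        rw [← Complex.exp_add]; ring_nf
      rw [← this]
      push_cast
      field_simp
    _ = _ := by rw [h2]

open Complex Real in
/-- If `u₂` is the next direction at `v` after `u₁`, then the left side of `u₁` and the right side of
`u₂` are connected in the complement of the drawing. -/
theorem ComplexDrawing.joinedIn_of_cyclicSucc {E : Type*} [Finite E] (G : ComplexDrawing E) {v : ℂ}
    (hv : ∀ e i, i < G.len e → v ∈ G.seg e i → v = G.pt e i ∨ v = G.pt e (i + 1))
    {u₁ u₂ : ℂ} (h₁ : G.IsDir v u₁) (h₂ : G.IsDir v u₂)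
    (h : CyclicSucc (arg '' {u | G.IsDir v u}) (arg u₁) (arg u₂)) {ε : ℝ} (hε : 0 < ε)
    (hthin : G.IsThin ε) :
    JoinedIn G.carrierᶜ (leftPoint ε v (v + u₁)) (leftPoint ε (v + u₂) v) := by
  obtain ⟨r, hr, H⟩ := G.exists_radius v hv
  have hn₁ := norm_pos_iff.2 h₁.ne_zero
  have hn₂ := norm_pos_iff.2 h₂.ne_zero
  have a1 := neg_pi_lt_arg u₁
  have a2 := arg_le_pi u₁
  have b1 := neg_pi_lt_arg u₂
  have b2 := arg_le_pi u₂
  have hpi := pi_pos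
  refine joinedIn_of_sector (α := cyclicGap (arg u₁) (arg u₂)) (r := r / ‖u₁‖) (c := ‖u₂‖ / ‖u₁‖)
    ?_ (by positivity) hε (by positivity) (eq_mul_exp_cyclicGap h₁.ne_zero) ?_
    (h₁.disjoint hthin).1 (h₂.disjoint hthin).2
  · unfold cyclicGap
    split_ifs <;> linarith
  -- A point of the drawing in the sector would give a direction at `v` strictly between `u₁` and
  -- its successor.
  · intro ρ θ hρ0 hρr hθ0 hθα hK
    have hnorm : ‖(ρ * u₁ * exp (θ * I) : ℂ)‖ = ρ * ‖u₁‖ := by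
      rw [norm_mul, norm_mul, norm_exp_ofReal_mul_I, norm_real, mul_one, norm_of_nonneg hρ0.le]
    obtain ⟨u, hu, t, ht, hut⟩ := H _ hK
      (by rw [dist_eq_norm, add_sub_cancel_left, hnorm]; exact (lt_div_iff₀ hn₁).1 hρr)
      (by
        intro h0
        have h1 : (ρ * u₁ * exp (θ * I) : ℂ) = 0 := by linear_combination h0
        rw [h1, norm_zero] at hnorm
        have := mul_pos hρ0 hn₁
        linarith)
    have hu' : arg u = arg (ρ * u₁ * exp (θ * I)) := by
      rw [add_left_cancel hut, arg_real_mul _ ht]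
    have hmem : arg u ∈ arg '' {u | G.IsDir v u} := ⟨u, hu, rfl⟩
    have c1 := neg_pi_lt_arg u
    have c2 := arg_le_pi u
    have hα2 : cyclicGap (arg u₁) (arg u₂) ≤ 2 * π := by
      unfold cyclicGap
      rcases h with ⟨h, -⟩ | ⟨h, -⟩
      · rw [if_pos h]; linarith
      · rw [if_neg (not_lt.2 h)]; linarith
    have hcases := arg_mul_exp_cases hρ0 h₁.ne_zero hθ0 (hθα.trans_le hα2)
    rw [← hu'] at hcases
    unfold cyclicGap at hθα
    rcases h with ⟨h, h'⟩ | ⟨h, h'⟩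
    · rw [if_pos h] at hθα
      have := h' _ hmem
      rcases hcases with h3 | h3
      · exact this ⟨by linarith, by linarith⟩
      · linarith
    · rw [if_neg (not_lt.2 h)] at hθα
      have := h' _ hmem
      rcases hcases with h3 | h3 <;> linarith [this.1, this.2]

/-! ### The winding function and paths along the sides of an edge. -/

namespace ComplexDrawing

variable {E : Type*} (G : ComplexDrawing E)

section Winding

variable [Fintype E]

/-- The sum of the complex logarithms that the segments subtend at `P`, with weight `z e` for the
edge `e`: for a cycle `z`, it is `2πi` times the winding number of `z` around `P`. -/
noncomputable def winding (z : E → ℂ) (P : ℂ) : ℂ :=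
  ∑ e, z e * ∑ i ∈ Finset.range (G.len e), Complex.log ((G.pt e (i + 1) - P) / (G.pt e i - P))

theorem hasDerivAt_winding {z : E → ℂ}
    (hz : ∀ g : ℂ → ℂ, ∑ e, z e * (g (G.pt e (G.len e)) - g (G.pt e 0)) = 0) {P : ℂ}
    (hP : P ∉ G.carrier) : HasDerivAt (G.winding z) 0 P := by
  have h : HasDerivAt (G.winding z) (∑ e, z e * ∑ i ∈ Finset.range (G.len e),
      ((G.pt e i - P)⁻¹ - (G.pt e (i + 1) - P)⁻¹)) P := by
    refine HasDerivAt.fun_sum fun e _ => HasDerivAt.const_mul _ (HasDerivAt.fun_sum fun i hi => ?_)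
    exact hasDerivAt_log_div fun hmem =>
      hP (G.mem_carrier.2 ⟨e, i, Finset.mem_range.1 hi, hmem⟩)
  convert h using 1
  -- The derivative telescopes along each edge, leaving the cycle condition for this particular
  -- vertex function.
  have h0 := hz fun x => -(x - P)⁻¹
  rw [← h0]
  refine Finset.sum_congr rfl fun e _ => ?_
  rw [Finset.sum_range_sub' (fun i => (G.pt e i - P)⁻¹)]
  ring

/-- The complement of the drawing is open and the derivative vanishes there, so the winding function
is locally constant, in particular along a path. -/
theorem winding_eq_of_joinedIn {z : E → ℂ}
    (hz : ∀ g : ℂ → ℂ, ∑ e, z e * (g (G.pt e (G.len e)) - g (G.pt e 0)) = 0) {x y : ℂ}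
    (h : JoinedIn G.carrierᶜ x y) : G.winding z x = G.winding z y := by
  have hloc : ∀ x ∈ G.carrierᶜ, ∀ᶠ y in 𝓝 x, G.winding z y = G.winding z x := by
    intro x hx
    obtain ⟨r, hr, hball⟩ := Metric.isOpen_iff.1 G.isClosed_carrier.isOpen_compl x hx
    filter_upwards [Metric.ball_mem_nhds x hr] with y hy
    have hd : ∀ w ∈ Metric.ball x r, HasDerivAt (G.winding z) 0 w :=
      fun w hw => G.hasDerivAt_winding hz (hball hw)
    exact Metric.isOpen_ball.is_const_of_deriv_eq_zero (convex_ball x r).isPreconnected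
      (fun w hw => (hd w hw).differentiableAt.differentiableWithinAt)
      (fun w hw => (hd w hw).deriv) hy (Metric.mem_ball_self hr)
  have hlc : IsLocallyConstant (fun t => G.winding z (h.somePath t)) := by
    rw [IsLocallyConstant.iff_eventually_eq]
    intro t
    exact h.somePath.continuous.continuousAt.eventually (hloc _ (h.somePath_mem t))
  have := hlc.apply_eq_of_preconnectedSpace 0 1
  simpa using this

/-- The winding function jumps by `2πi z e` across a segment of the edge `e`. -/
theorem winding_sub_winding {z : E → ℂ}
    (hz : ∀ g : ℂ → ℂ, ∑ e, z e * (g (G.pt e (G.len e)) - g (G.pt e 0)) = 0) {ε : ℝ} (hε : 0 < ε)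
    (hthin : G.IsThin ε) {e : E} {i : ℕ} (hi : i < G.len e) :
    G.winding z (leftPoint ε (G.pt e i) (G.pt e (i + 1))) -
      G.winding z (leftPoint ε (G.pt e (i + 1)) (G.pt e i)) = 2 * Real.pi * Complex.I * z e := by
  classical
  set a := G.pt e i with ha
  set b := G.pt e (i + 1) with hb
  have hab : a ≠ b := G.pt_ne e i hi
  -- The jump does not depend on the height of the triangles, so it equals its limit as the height
  -- tends to `0`.
  have lim1 : Tendsto (fun δ : ℝ => G.winding z (leftPoint δ a b) - G.winding z (leftPoint δ b a))
      (𝓝[>] 0) (𝓝 (G.winding z (leftPoint ε a b) - G.winding z (leftPoint ε b a))) := by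
    refine tendsto_const_nhds.congr' ?_
    filter_upwards [Ioo_mem_nhdsGT hε] with δ hδ
    congr 1 <;> refine G.winding_eq_of_joinedIn hz ?_
    · exact ((isPathConnected_leftTriangle hε a b).joinedIn _
        (leftPoint_mem_leftTriangle hε le_rfl _ _) _
        (leftPoint_mem_leftTriangle hδ.1 hδ.2.le _ _)).mono (hthin e i hi).1.subset_compl_right
    · exact ((isPathConnected_leftTriangle hε b a).joinedIn _
        (leftPoint_mem_leftTriangle hε le_rfl _ _) _
        (leftPoint_mem_leftTriangle hδ.1 hδ.2.le _ _)).mono (hthin e i hi).2.subset_compl_right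
  have lim2 : Tendsto (fun δ : ℝ => G.winding z (leftPoint δ a b) - G.winding z (leftPoint δ b a))
      (𝓝[>] 0) (𝓝 (∑ f, z f * ∑ j ∈ Finset.range (G.len f),
        if f = e ∧ j = i then 2 * Real.pi * Complex.I else 0)) := by
    simp only [winding, ← Finset.sum_sub_distrib, ← mul_sub]
    refine tendsto_finsetSum _ fun f _ => Tendsto.const_mul _ (tendsto_finsetSum _ fun j hj => ?_)
    rw [Finset.mem_range] at hj
    split_ifs with h
    · obtain ⟨rfl, rfl⟩ := h
      exact tendsto_log_div_sub hab
    -- Every other segment misses the midpoint of `a b`, so its logarithm is continuous there and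
    -- contributes no jump.
    · have hmid : leftPoint 0 a b ∉ segment ℝ (G.pt f j) (G.pt f (j + 1)) := by
        intro hmem
        refine G.notMem_openSegment (fun h' => h ⟨h'.1.symm, h'.2.symm⟩) hi hj hmem ?_
        rw [openSegment_eq_image']
        refine ⟨1 / 2, ⟨by norm_num, by norm_num⟩, ?_⟩
        simp only [Complex.real_smul, leftPoint]
        push_cast
        ring
      have hmid' : leftPoint 0 b a = leftPoint 0 a b := by
        simp only [leftPoint]; push_cast; ring
      have hc : ContinuousAt
          (fun P => Complex.log ((G.pt f (j + 1) - P) / (G.pt f j - P))) (leftPoint 0 a b) :=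
        (hasDerivAt_log_div hmid).continuousAt
      have t1 : Tendsto (fun δ : ℝ => leftPoint δ a b) (𝓝[>] 0) (𝓝 (leftPoint 0 a b)) :=
        tendsto_nhdsWithin_of_tendsto_nhds
          (Continuous.tendsto (by unfold leftPoint; fun_prop) 0)
      have t2 : Tendsto (fun δ : ℝ => leftPoint δ b a) (𝓝[>] 0) (𝓝 (leftPoint 0 a b)) := by
        rw [← hmid']
        exact tendsto_nhdsWithin_of_tendsto_nhds
          (Continuous.tendsto (by unfold leftPoint; fun_prop) 0)
      have := (hc.tendsto.comp t1).sub (hc.tendsto.comp t2)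
      rwa [sub_self] at this
  rw [tendsto_nhds_unique lim1 lim2, Finset.sum_eq_single e]
  · rw [Finset.sum_eq_single i]
    · simp [mul_comm]
    · intro j _ hj
      simp [hj]
    · intro h
      exact absurd (Finset.mem_range.2 hi) h
  · intro f _ hf
    simp [hf]
  · simp

end Winding

theorem bend_eq_or {e : E} {i : ℕ} (hi : i + 1 < G.len e) {f : E} {j : ℕ} (hj : j < G.len f)
    (h : G.pt e (i + 1) ∈ G.seg f j) :
    G.pt e (i + 1) = G.pt f j ∨ G.pt e (i + 1) = G.pt f (j + 1) := by
  obtain ⟨rfl, rfl | rfl⟩ := G.bend_mem_seg hi hj h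
  · exact Or.inr rfl
  · exact Or.inl rfl

theorem isDir_bend {e : E} {i : ℕ} (hi : i + 1 < G.len e) {u : ℂ}
    (h : G.IsDir (G.pt e (i + 1)) u) :
    u = G.pt e (i + 2) - G.pt e (i + 1) ∨ u = G.pt e i - G.pt e (i + 1) := by
  obtain ⟨f, j, hj, ⟨h1, h2⟩ | ⟨h1, h2⟩⟩ := h
  · have hm := G.pt_mem_seg_left f j
    rw [← h1] at hm
    obtain ⟨rfl, rfl | rfl⟩ := G.bend_mem_seg hi hj hm
    · exact absurd h1.symm (G.pt_ne f j hj)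
    · exact Or.inl h2
  · have hm := G.pt_mem_seg_right f j
    rw [← h1] at hm
    obtain ⟨rfl, rfl | rfl⟩ := G.bend_mem_seg hi hj hm
    · exact Or.inr h2
    · exact absurd h1 (G.pt_ne f (i + 1) hj)

theorem joinedIn_bend [Finite E] {e : E} {i : ℕ} (hi : i + 1 < G.len e) {ε : ℝ} (hε : 0 < ε)
    (hthin : G.IsThin ε) :
    JoinedIn G.carrierᶜ (leftPoint ε (G.pt e i) (G.pt e (i + 1)))
        (leftPoint ε (G.pt e (i + 1)) (G.pt e (i + 2))) ∧
      JoinedIn G.carrierᶜ (leftPoint ε (G.pt e (i + 1)) (G.pt e i))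
        (leftPoint ε (G.pt e (i + 2)) (G.pt e (i + 1))) := by
  have hv := fun f j hj => G.bend_eq_or hi (f := f) (j := j) hj
  have h₁ : G.IsDir (G.pt e (i + 1)) (G.pt e (i + 2) - G.pt e (i + 1)) :=
    ⟨e, i + 1, hi, Or.inl ⟨rfl, rfl⟩⟩
  have h₂ : G.IsDir (G.pt e (i + 1)) (G.pt e i - G.pt e (i + 1)) :=
    ⟨e, i, by omega, Or.inr ⟨rfl, rfl⟩⟩
  -- A bend has only two directions, so each is the cyclic successor of the other.
  have hcyc : ∀ A : Set ℝ, ∀ x y : ℝ, (∀ a ∈ A, a = x ∨ a = y) → CyclicSucc A x y := by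
    intro A x y hA
    rcases lt_or_ge x y with h | h
    · refine Or.inl ⟨h, fun a ha h' => ?_⟩
      rcases hA a ha with rfl | rfl
      · exact lt_irrefl _ h'.1
      · exact lt_irrefl _ h'.2
    · refine Or.inr ⟨h, fun a ha => ?_⟩
      rcases hA a ha with rfl | rfl
      · exact ⟨h, le_rfl⟩
      · exact ⟨le_rfl, h⟩
  have j₁ := G.joinedIn_of_cyclicSucc hv h₁ h₂ (hcyc _ _ _ (by
    rintro _ ⟨u, hu, rfl⟩
    rcases G.isDir_bend hi hu with rfl | rfl
    · exact Or.inl rfl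
    · exact Or.inr rfl)) hε hthin
  have j₂ := G.joinedIn_of_cyclicSucc hv h₂ h₁ (hcyc _ _ _ (by
    rintro _ ⟨u, hu, rfl⟩
    rcases G.isDir_bend hi hu with rfl | rfl
    · exact Or.inr rfl
    · exact Or.inl rfl)) hε hthin
  simp only [add_sub_cancel] at j₁ j₂
  exact ⟨j₁.symm, j₂⟩

theorem joinedIn_edge [Finite E] (e : E) {ε : ℝ} (hε : 0 < ε) (hthin : G.IsThin ε) (i : ℕ)
    (hi : i < G.len e) :
    JoinedIn G.carrierᶜ (leftPoint ε (G.pt e 0) (G.pt e 1))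
        (leftPoint ε (G.pt e i) (G.pt e (i + 1))) ∧
      JoinedIn G.carrierᶜ (leftPoint ε (G.pt e 1) (G.pt e 0))
        (leftPoint ε (G.pt e (i + 1)) (G.pt e i)) := by
  induction i with
  | zero =>
    have h0 := hthin e 0 hi
    exact ⟨JoinedIn.refl (h0.1.subset_compl_right (leftPoint_mem_leftTriangle hε le_rfl _ _)),
      JoinedIn.refl (h0.2.subset_compl_right (leftPoint_mem_leftTriangle hε le_rfl _ _))⟩
  | succ i ih =>
    have h1 := ih (by omega)
    have h2 := G.joinedIn_bend hi hε hthin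
    exact ⟨h1.1.trans h2.1, h1.2.trans h2.2⟩

/-! ### Darts, faces and the upper bound for drawings. -/

/-- The initial point of a directed edge. -/
def dartSource (d : E × Bool) : ℂ := if d.2 then G.pt d.1 0 else G.pt d.1 (G.len d.1)

/-- The index of the initial segment of a directed edge. -/
def dartIndex (d : E × Bool) : ℕ := if d.2 then 0 else G.len d.1 - 1

/-- The direction vector of the initial segment of a directed edge. -/
def dartDir (d : E × Bool) : ℂ :=
  if d.2 then G.pt d.1 1 - G.pt d.1 0 else G.pt d.1 (G.len d.1 - 1) - G.pt d.1 (G.len d.1)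

theorem dartSource_mem (d : E × Bool) : G.dartSource d ∈ G.verts := by
  obtain ⟨e, _ | _⟩ := d
  · exact G.target_mem e
  · exact G.source_mem e

theorem dartIndex_lt (d : E × Bool) : G.dartIndex d < G.len d.1 := by
  have := G.len_pos d.1
  unfold dartIndex
  split_ifs <;> omega

theorem len_sub_one_add_one (e : E) : G.len e - 1 + 1 = G.len e := by
  have := G.len_pos e
  omega

theorem isDir_dart (d : E × Bool) : G.IsDir (G.dartSource d) (G.dartDir d) := by
  refine ⟨d.1, G.dartIndex d, G.dartIndex_lt d, ?_⟩
  obtain ⟨e, _ | _⟩ := d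
  · right
    simp [dartSource, dartDir, dartIndex, G.len_sub_one_add_one]
  · left
    simp [dartSource, dartDir, dartIndex]

theorem exists_dart_of_isDir {v u : ℂ} (hv : v ∈ G.verts) (h : G.IsDir v u) :
    ∃ d, G.dartSource d = v ∧ G.dartDir d = u := by
  obtain ⟨e, i, hi, ⟨rfl, rfl⟩ | ⟨rfl, rfl⟩⟩ := h
  · rcases G.vertex_mem_seg hi hv (G.pt_mem_seg_left e i) with ⟨rfl, h⟩ | ⟨h1, h2⟩
    · exact ⟨(e, true), by simp [dartSource], by simp [dartDir]⟩
    · exact absurd h2 (by rw [← h1]; exact G.pt_ne e i hi)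
  · rcases G.vertex_mem_seg hi hv (G.pt_mem_seg_right e i) with ⟨rfl, h⟩ | ⟨h1, h2⟩
    · exact absurd h.symm (G.pt_ne e 0 hi)
    · refine ⟨(e, false), by simp [dartSource, h2], ?_⟩
      simp [dartDir, ← h1]

theorem segment_dart (d : E × Bool) :
    segment ℝ (G.dartSource d) (G.dartSource d + G.dartDir d) = G.seg d.1 (G.dartIndex d) := by
  obtain ⟨e, _ | _⟩ := d
  · rw [segment_symm]
    simp [dartSource, dartDir, dartIndex, G.len_sub_one_add_one, seg]
  · simp [dartSource, dartDir, dartIndex, seg]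

theorem openSegment_dart (d : E × Bool) :
    openSegment ℝ (G.dartSource d) (G.dartSource d + G.dartDir d) =
      openSegment ℝ (G.pt d.1 (G.dartIndex d)) (G.pt d.1 (G.dartIndex d + 1)) := by
  obtain ⟨e, _ | _⟩ := d
  · rw [openSegment_symm]
    simp [dartSource, dartDir, dartIndex, G.len_sub_one_add_one]
  · simp [dartSource, dartDir, dartIndex]

/-- Two distinct segments leaving a vertex in the same direction would overlap: the midpoint of the
shorter one would lie on the other. -/
theorem dart_eq_of_arg_eq {d d' : E × Bool} (hs : G.dartSource d = G.dartSource d')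
    (ha : (G.dartDir d).arg = (G.dartDir d').arg) : d = d' := by
  have main : ∀ d d' : E × Bool, G.dartSource d = G.dartSource d' →
      (G.dartDir d).arg = (G.dartDir d').arg → ‖G.dartDir d‖ ≤ ‖G.dartDir d'‖ →
      d.1 = d'.1 ∧ G.dartIndex d = G.dartIndex d' := by
    intro d d' hs ha hn
    by_contra hne
    have hd := (G.isDir_dart d).ne_zero
    have hd' := (G.isDir_dart d').ne_zero
    have h := (Complex.arg_eq_arg_iff hd hd').1 ha
    set v := G.dartSource d with hv
    have hpos := norm_pos_iff.2 hd
    have hpos' := norm_pos_iff.2 hd'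
    refine G.notMem_openSegment (x := v + (1 / 2 : ℝ) * G.dartDir d) hne (G.dartIndex_lt d)
      (G.dartIndex_lt d') ?_ ?_
    · rw [← segment_dart, ← hs, segment_eq_image']
      refine ⟨‖G.dartDir d‖ / ‖G.dartDir d'‖ / 2, ⟨by positivity, ?_⟩, ?_⟩
      · have := (div_le_one hpos').2 hn
        linarith
      · have e1 : (‖G.dartDir d‖ : ℂ) ≠ 0 := by exact_mod_cast hpos.ne'
        have e2 : (‖G.dartDir d'‖ : ℂ) ≠ 0 := by exact_mod_cast hpos'.ne'
        rw [div_mul_eq_mul_div, div_eq_iff e1] at h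
        simp only [add_sub_cancel_left, Complex.real_smul]
        push_cast
        field_simp
        linear_combination -h
    · rw [← openSegment_dart, openSegment_eq_image']
      exact ⟨1 / 2, ⟨by norm_num, by norm_num⟩, by simp [hv]⟩
  have key : d.1 = d'.1 ∧ G.dartIndex d = G.dartIndex d' := by
    rcases le_total ‖G.dartDir d‖ ‖G.dartDir d'‖ with h | h
    · exact main d d' hs ha h
    · have := main d' d hs.symm ha.symm h
      exact ⟨this.1.symm, this.2.symm⟩
  obtain ⟨e, b⟩ := d
  obtain ⟨e', b'⟩ := d'
  obtain ⟨h1, h2⟩ := key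
  obtain rfl : e = e' := h1
  have hne := G.pt_ne e 0 (G.len_pos e)
  have hl := G.len_pos e
  -- Opposite darts share their segment only if the edge has length `1`; then their sources are its
  -- two distinct endpoints.
  rcases b with _ | _ <;> rcases b' with _ | _ <;> simp [dartIndex, dartSource] at h2 hs ⊢
  · have : G.len e = 1 := by omega
    rw [this] at hs
    exact hne hs.symm
  · have : G.len e = 1 := by omega
    rw [this] at hs
    exact hne hs

/-- The left side of a directed edge at its beginning is connected to the right side of the reverse
edge at its beginning. -/
theorem joinedIn_reverse [Finite E] (d : E × Bool) {ε : ℝ} (hε : 0 < ε) (hthin : G.IsThin ε) :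
    JoinedIn G.carrierᶜ (leftPoint ε (G.dartSource d) (G.dartSource d + G.dartDir d))
      (leftPoint ε (G.dartSource (d.1, !d.2) + G.dartDir (d.1, !d.2))
        (G.dartSource (d.1, !d.2))) := by
  obtain ⟨e, b⟩ := d
  have h := G.joinedIn_edge e hε hthin (G.len e - 1) (by have := G.len_pos e; omega)
  rw [G.len_sub_one_add_one] at h
  rcases b with _ | _
  · simpa [dartSource, dartDir] using h.2.symm
  · simpa [dartSource, dartDir] using h.1

/-- A plane multigraph whose edges have ends that are parallel or orthogonal has at most
`5 n - 2` edges. -/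
theorem card_add_two_le [Fintype E] [Nonempty E]
    (hfin : ∀ e, ∃ m : ℤ, (G.dartDir (e, false)).arg =
      (G.dartDir (e, true)).arg + m * (Real.pi / 2)) :
    Fintype.card E + 2 ≤ 5 * G.verts.card := by
  classical
  let vtx : E × Bool → {x // x ∈ G.verts} := fun d => ⟨G.dartSource d, G.dartSource_mem d⟩
  let f : E × Bool → ℝ := fun d => (G.dartDir d).arg
  have hinj : ∀ d d', vtx d = vtx d' → f d = f d' → d = d' := fun d d' h1 h2 =>
    G.dart_eq_of_arg_eq (congrArg Subtype.val h1) h2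
  obtain ⟨σ, hσ⟩ := exists_perm_cyclicSucc vtx f hinj
  let rev : Equiv.Perm (E × Bool) := Equiv.prodCongr (Equiv.refl E) Equiv.boolNot
  have hrev : ∀ d, ∃ m : ℤ, f (rev d) = f d + m * (Real.pi / 2) := by
    rintro ⟨e, _ | _⟩
    · obtain ⟨m, hm⟩ := hfin e
      refine ⟨-m, ?_⟩
      change (G.dartDir (e, true)).arg = (G.dartDir (e, false)).arg + _
      rw [hm]
      push_cast
      ring
    · exact hfin e
  have h1 := card_faces_mul_le_sum_cyclicGap f (fun d => Complex.neg_pi_lt_arg _)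
    (fun d => Complex.arg_le_pi _) σ rev hrev
  have h2 := sum_cyclicGap_le vtx f hinj σ (fun d => (hσ d).2)
  set F := Quotient (Equiv.Perm.SameCycle.setoid (rev.trans σ)) with hF
  let _ : Fintype F := Fintype.ofFinite F
  rw [Nat.card_eq_fintype_card] at h1
  rw [Fintype.card_coe] at h2
  have h3 : Fintype.card F ≤ 4 * G.verts.card := by
    have hpi := Real.pi_pos
    have : (Fintype.card F : ℝ) ≤ 4 * G.verts.card := by nlinarith
    exact_mod_cast this
  obtain ⟨ε, hthin, hε : 0 < ε⟩ := (G.eventually_isThin.and self_mem_nhdsWithin).exists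
  let face : E × Bool → F := fun d => Quotient.mk _ d
  have h4 : Fintype.card E + 2 ≤ Fintype.card {x // x ∈ G.verts} + Fintype.card F := by
    refine card_add_two_le_of_cycles_bound (fun e => vtx (e, true)) (fun e => vtx (e, false))
      (fun e => face (e, false)) (fun e => face (e, true)) fun z hz => ?_
    have hz' : ∀ g : ℂ → ℂ, ∑ e, z e * (g (G.pt e (G.len e)) - g (G.pt e 0)) = 0 := by
      intro g
      simpa [vtx, dartSource] using hz fun x => g x
    -- The face potential is the winding function just to the right of a dart.
    let right : E × Bool → ℂ := fun d =>
      G.winding z (leftPoint ε (G.dartSource d + G.dartDir d) (G.dartSource d))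
    -- The right side of `σ (rev d)` is joined through the sector to the left side of `rev d`, and
    -- from there along the edge to the right side of `d`.
    have hstep : ∀ d, right ((rev.trans σ) d) = right d := by
      intro d
      have hs : G.dartSource (σ (rev d)) = G.dartSource (rev d) :=
        congrArg Subtype.val (hσ (rev d)).1
      have hj := G.joinedIn_of_cyclicSucc (v := G.dartSource (rev d))
        (u₁ := G.dartDir (rev d)) (u₂ := G.dartDir (σ (rev d))) ?_ (G.isDir_dart _)
        (by rw [← hs]; exact G.isDir_dart _) ?_ hε hthin
      · have hj' := G.joinedIn_reverse (rev d) hε hthin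
        have hrr : (((rev d).1, !(rev d).2) : E × Bool) = d := by simp [rev]
        rw [hrr] at hj'
        change G.winding z (leftPoint ε (G.dartSource (σ (rev d)) + G.dartDir (σ (rev d)))
          (G.dartSource (σ (rev d)))) = _
        rw [hs]
        exact G.winding_eq_of_joinedIn hz' (hj.symm.trans hj')
      · intro e i hi hmem
        rcases G.vertex_mem_seg hi (G.dartSource_mem _) hmem with ⟨rfl, h⟩ | ⟨h, h'⟩
        · exact Or.inl h
        · exact Or.inr (by rw [h]; exact h')
      · have hc := (hσ (rev d)).2
        convert hc using 1
        ext x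
        constructor
        · rintro ⟨u, hu, rfl⟩
          obtain ⟨d', hd', rfl⟩ := G.exists_dart_of_isDir (G.dartSource_mem _) hu
          exact ⟨d', Subtype.ext hd', rfl⟩
        · rintro ⟨d', hd', rfl⟩
          refine ⟨G.dartDir d', ?_, rfl⟩
          have hsrc : G.dartSource d' = G.dartSource (rev d) := congrArg Subtype.val hd'
          change G.IsDir _ _
          rw [← hsrc]
          exact G.isDir_dart d'
    have hcycle : ∀ d d', Equiv.Perm.SameCycle (rev.trans σ) d d' → right d = right d' := by
      rintro d _ ⟨k, rfl⟩
      have hpow : ∀ (n : ℕ) d, right (((rev.trans σ) ^ n) d) = right d := by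
        intro n
        induction n with
        | zero => intro d; rfl
        | succ n ih => intro d; rw [pow_succ', Equiv.Perm.mul_apply, hstep, ih]
      obtain ⟨n, rfl | rfl⟩ := k.eq_nat_or_neg
      · rw [zpow_natCast, hpow]
      · have := hpow n (((rev.trans σ) ^ (-(n : ℤ))) d)
        rw [← this, zpow_neg, zpow_natCast]
        simp
    refine ⟨fun q => Quotient.lift right hcycle q / (2 * Real.pi * Complex.I), fun e => ?_⟩
    change _ = right (e, false) / _ - right (e, true) / _
    -- The left side of `(e, true)` carries the potential of `(e, false)`, so the jump across `e` is
    -- the required difference.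
    have hjump := G.winding_sub_winding hz' hε hthin (G.len_pos e)
    have hl := G.winding_eq_of_joinedIn hz' (G.joinedIn_reverse (e, true) hε hthin)
    have hl' : G.winding z (leftPoint ε (G.pt e 0) (G.pt e (0 + 1))) = right (e, false) := by
      rw [← show _ = right (e, false) from hl]
      simp [dartSource, dartDir]
    have hr' : G.winding z (leftPoint ε (G.pt e (0 + 1)) (G.pt e 0)) = right (e, true) := by
      simp [right, dartSource, dartDir]
    rw [hl', hr'] at hjump
    rw [← sub_div, hjump, mul_div_cancel_left₀]
    exact Complex.two_pi_I_ne_zero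
  rw [Fintype.card_coe] at h4
  omega

end ComplexDrawing

/-! ### Transfer from the Euclidean plane to the complex plane. -/

-- A nonzero quotient on the real or imaginary axis has argument a multiple of `π / 2`; `arg`
-- respects quotients modulo `2π`, which is four such units.
open Complex Real in
theorem exists_arg_eq_add_mul_pi_div_two {u w : ℂ} (hu : u ≠ 0) (hw : w ≠ 0)
    (h : (w / u).im = 0 ∨ (w / u).re = 0) : ∃ m : ℤ, arg w = arg u + m * (π / 2) := by
  have hq : ∃ m : ℤ, arg (w / u) = m * (π / 2) := by
    have hne : w / u ≠ 0 := div_ne_zero hw hu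
    rcases h with h | h
    · rcases lt_trichotomy (w / u).re 0 with h' | h' | h'
      · exact ⟨2, by rw [arg_eq_pi_iff.2 ⟨h', h⟩]; push_cast; ring⟩
      · exact absurd (Complex.ext h' h) hne
      · exact ⟨0, by rw [arg_eq_zero_iff.2 ⟨h'.le, h⟩]; simp⟩
    · rcases lt_trichotomy (w / u).im 0 with h' | h' | h'
      · exact ⟨-1, by rw [arg_eq_neg_pi_div_two_iff.2 ⟨h, h'⟩]; push_cast; ring⟩
      · exact absurd (Complex.ext h h') hne
      · exact ⟨1, by rw [arg_eq_pi_div_two_iff.2 ⟨h, h'⟩]; push_cast; ring⟩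
  obtain ⟨m, hm⟩ := hq
  have h1 := arg_div_coe_angle hw hu
  rw [← Angle.coe_sub] at h1
  obtain ⟨k, hk⟩ := Angle.angle_eq_iff_two_pi_dvd_sub.1 h1
  refine ⟨m - 4 * k, ?_⟩
  push_cast
  linarith

/-- The standard isometry from the Euclidean plane to the complex plane. -/
noncomputable def planeToComplex : Plane ≃ₗᵢ[ℝ] ℂ := Complex.orthonormalBasisOneI.repr.symm

theorem map_mem_segment_iff {a b x : Plane} :
    planeToComplex x ∈ segment ℝ (planeToComplex a) (planeToComplex b) ↔ x ∈ segment ℝ a b := by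
  constructor
  · rintro ⟨s, t, hs, ht, hst, h⟩
    refine ⟨s, t, hs, ht, hst, planeToComplex.injective ?_⟩
    rw [← h, map_add, map_smul, map_smul]
  · rintro ⟨s, t, hs, ht, hst, rfl⟩
    exact ⟨s, t, hs, ht, hst, by rw [map_add, map_smul, map_smul]⟩

namespace PolygonalPath

/-- The points of a polygonal path in the complex plane, indexed by natural numbers. -/
noncomputable def complexPt (γ : PolygonalPath) (i : ℕ) : ℂ :=
  if h : i < γ.bends + 2 then planeToComplex (γ.pt ⟨i, h⟩) else 0

theorem complexPt_castSucc (γ : PolygonalPath) (i : Fin (γ.bends + 1)) :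
    γ.complexPt i = planeToComplex (γ.pt i.castSucc) := by
  rw [complexPt, dif_pos (by omega)]
  rfl

theorem complexPt_succ (γ : PolygonalPath) (i : Fin (γ.bends + 1)) :
    γ.complexPt (i + 1) = planeToComplex (γ.pt i.succ) := by
  rw [complexPt, dif_pos (by omega)]
  rfl

theorem complexPt_zero (γ : PolygonalPath) : γ.complexPt 0 = planeToComplex γ.source := by
  rw [complexPt, dif_pos (by omega)]
  rfl

theorem complexPt_last (γ : PolygonalPath) :
    γ.complexPt (γ.bends + 1) = planeToComplex γ.target := by
  rw [complexPt, dif_pos (by omega)]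
  rfl

theorem map_mem_complex_segment_iff (γ : PolygonalPath) (i : Fin (γ.bends + 1)) {x : Plane} :
    planeToComplex x ∈ segment ℝ (γ.complexPt i) (γ.complexPt (i + 1)) ↔
      x ∈ segment ℝ (γ.pt i.castSucc) (γ.pt i.succ) := by
  rw [complexPt_castSucc, complexPt_succ, map_mem_segment_iff]

theorem mem_carrier {γ : PolygonalPath} {x : Plane} :
    x ∈ γ.carrier ↔ ∃ i : Fin (γ.bends + 1), x ∈ segment ℝ (γ.pt i.castSucc) (γ.pt i.succ) :=
  Set.mem_iUnion

end PolygonalPath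

/-- A plane multigraph as a drawing in the complex plane. -/
noncomputable def PlaneMultigraph.toComplexDrawing {E : Type*} (G : PlaneMultigraph E) :
    ComplexDrawing E where
  verts := G.verts.map planeToComplex.toEquiv.toEmbedding
  len e := (G.edge e).bends + 1
  pt e := (G.edge e).complexPt
  len_pos e := Nat.succ_pos _
  pt_ne e i hi := by
    have h := (G.edge e).pt_ne ⟨i, hi⟩
    have h1 := (G.edge e).complexPt_castSucc ⟨i, hi⟩
    have h2 := (G.edge e).complexPt_succ ⟨i, hi⟩
    simp only at h1 h2
    rw [h1, h2]
    exact fun h' => h (planeToComplex.injective h')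
  simple e i j hij hj x hxi hxj := by
    obtain ⟨y, rfl⟩ := planeToComplex.surjective x
    have h1 := ((G.edge e).map_mem_complex_segment_iff ⟨i, by omega⟩).1 hxi
    have h2 := ((G.edge e).map_mem_complex_segment_iff ⟨j, hj⟩).1 hxj
    rcases (G.edge e).simple ⟨i, by omega⟩ ⟨j, hj⟩ hij y h1 h2 with ⟨h3, h4⟩ | ⟨h3, h4, h5, h6⟩
    · have h7 : i + 1 = j := congrArg Fin.val h3
      refine Or.inl ⟨h7, ?_⟩
      subst h7
      rw [h4]
      exact ((G.edge e).complexPt_succ ⟨i, by omega⟩).symm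
    · have h7 : i = 0 := congrArg Fin.val h3
      have h8 : j = (G.edge e).bends := congrArg Fin.val h4
      refine Or.inr ⟨h7, by omega, ?_, ?_⟩
      · rw [h5, (G.edge e).complexPt_zero]; rfl
      · rw [h6, (G.edge e).complexPt_last]; rfl
  source_mem e := by
    rw [(G.edge e).complexPt_zero]
    exact Finset.mem_map_of_mem _ (G.source_mem e)
  target_mem e := by
    rw [(G.edge e).complexPt_last]
    exact Finset.mem_map_of_mem _ (G.target_mem e)
  vertex_on_edge e i hi v hv hvi := by
    obtain ⟨y, hy, rfl⟩ := Finset.mem_map.1 hv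
    have h1 := ((G.edge e).map_mem_complex_segment_iff ⟨i, hi⟩).1 hvi
    rw [(G.edge e).complexPt_zero, (G.edge e).complexPt_last]
    exact (G.vertex_on_edge e y hy (PolygonalPath.mem_carrier.2 ⟨_, h1⟩)).imp
      (congrArg planeToComplex) (congrArg planeToComplex)
  edge_inter e f i j hef hi hj x hxi hxj := by
    obtain ⟨y, rfl⟩ := planeToComplex.surjective x
    have h1 := ((G.edge e).map_mem_complex_segment_iff ⟨i, hi⟩).1 hxi
    have h2 := ((G.edge f).map_mem_complex_segment_iff ⟨j, hj⟩).1 hxj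
    exact Finset.mem_map_of_mem _ (G.edge_inter e f hef
      ⟨PolygonalPath.mem_carrier.2 ⟨_, h1⟩, PolygonalPath.mem_carrier.2 ⟨_, h2⟩⟩)

theorem PlaneMultigraph.IsOrthoFin.card_add_two_le {E : Type*} [Fintype E] [Nonempty E]
    {G : PlaneMultigraph E} (hG : G.IsOrthoFin) : Fintype.card E + 2 ≤ 5 * G.verts.card := by
  have h := G.toComplexDrawing.card_add_two_le fun e => ?_
  · simpa [toComplexDrawing] using h
  · set γ := G.edge e with hγ
    have ht : G.toComplexDrawing.dartDir (e, true) = planeToComplex (γ.dir 0) := by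
      have h1 := γ.complexPt_succ 0
      have h2 := γ.complexPt_castSucc 0
      simp only [Fin.val_zero, zero_add] at h1 h2
      rw [PolygonalPath.dir, map_sub, ← h1, ← h2]
      rfl
    have hf : G.toComplexDrawing.dartDir (e, false) = -planeToComplex (γ.dir (Fin.last _)) := by
      have h1 := γ.complexPt_succ (Fin.last _)
      have h2 := γ.complexPt_castSucc (Fin.last _)
      rw [PolygonalPath.dir, map_sub, ← h1, ← h2, neg_sub]
      rfl
    have hu := (G.toComplexDrawing.isDir_dart (e, true)).ne_zero
    have hw := (G.toComplexDrawing.isDir_dart (e, false)).ne_zero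
    refine exists_arg_eq_add_mul_pi_div_two hu hw ?_
    rw [hf, ht]
    rw [ht] at hu
    rcases hG e with ⟨c, hc⟩ | hc
    · left
      rw [hc, map_smul, Complex.real_smul, neg_div, mul_div_cancel_right₀ _ hu]
      simp
    · right
      have hc' : inner ℝ (γ.dir 0) (γ.dir (Fin.last γ.bends)) = 0 := hc
      rw [← planeToComplex.inner_map_map, Complex.inner] at hc'
      simp only [Complex.mul_re, Complex.conj_re, Complex.conj_im] at hc'
      rw [neg_div, Complex.neg_re, Complex.div_re, ← add_div, neg_eq_zero, div_eq_zero_iff]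
      left
      linarith

/-- The subgraph with the given edges and vertices. -/
def PlaneMultigraph.restrict {E E' : Type*} (G : PlaneMultigraph E) (ι : E' ↪ E) (V : Finset Plane)
    (hV : V ⊆ G.verts) (hs : ∀ e, (G.edge (ι e)).source ∈ V) (ht : ∀ e, (G.edge (ι e)).target ∈ V) :
    PlaneMultigraph E' where
  verts := V
  edge e := G.edge (ι e)
  source_mem := hs
  target_mem := ht
  vertex_on_edge e v hv := G.vertex_on_edge (ι e) v (hV hv)
  edge_inter e f h x hx := by
    have hx' := G.edge_inter (ι e) (ι f) (fun h' => h (ι.injective h')) hx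
    rcases G.vertex_on_edge (ι e) x hx' hx.1 with rfl | rfl
    · exact hs e
    · exact ht e

/-- The bound for every finite subfamily of edges forces the whole family to be finite. -/
theorem PlaneMultigraph.IsOrthoFin.finite_and_card_le {E : Type*} {G : PlaneMultigraph E}
    (hG : G.IsOrthoFin) : Finite E ∧ Nat.card E ≤ 5 * G.verts.card - 2 := by
  have key : ∀ s : Finset E, s.card ≤ 5 * G.verts.card - 2 := by
    intro s
    rcases s.eq_empty_or_nonempty with rfl | hs
    · simp
    · have : Nonempty s := hs.to_subtype
      have hs' : (G.restrict (Function.Embedding.subtype (· ∈ s)) G.verts subset_rfl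
          (fun e => G.source_mem e) fun e => G.target_mem e).IsOrthoFin := fun e => hG e
      have h : Fintype.card s + 2 ≤ 5 * G.verts.card := hs'.card_add_two_le
      rw [Fintype.card_coe] at h
      omega
  have hfin : Finite E := by
    by_contra hE
    rw [not_finite_iff_infinite] at hE
    obtain ⟨s, hs⟩ := Infinite.exists_subset_card_eq E (5 * G.verts.card - 2 + 1)
    have := key s
    omega
  refine ⟨hfin, ?_⟩
  have := Fintype.ofFinite E
  rw [Nat.card_eq_fintype_card]
  exact key Finset.univ

/-! ### Affine images and gluing. -/

/-- The image of a polygonal path under an injective affine map. -/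
noncomputable def PolygonalPath.map (γ : PolygonalPath) (f : Plane →ᵃ[ℝ] Plane)
    (hf : Function.Injective f) : PolygonalPath where
  bends := γ.bends
  pt i := f (γ.pt i)
  pt_ne i h := γ.pt_ne i (hf h)
  simple i j hij x hi hj := by
    rw [← image_segment] at hi hj
    obtain ⟨y, hy, rfl⟩ := hi
    obtain ⟨z, hz, hzy⟩ := hj
    obtain rfl := hf hzy
    rcases γ.simple i j hij z hy hz with ⟨h1, h2⟩ | ⟨h1, h2, h3, h4⟩
    · exact Or.inl ⟨h1, congrArg f h2⟩
    · exact Or.inr ⟨h1, h2, congrArg f h3, congrArg f h4⟩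

theorem PolygonalPath.carrier_map (γ : PolygonalPath) (f : Plane →ᵃ[ℝ] Plane)
    (hf : Function.Injective f) : (γ.map f hf).carrier = f '' γ.carrier := by
  simp only [carrier, Set.image_iUnion, image_segment]
  rfl

theorem PolygonalPath.dir_map (γ : PolygonalPath) (f : Plane →ᵃ[ℝ] Plane)
    (hf : Function.Injective f) (i : Fin (γ.bends + 1)) :
    (γ.map f hf).dir i = f.linear (γ.dir i) := by
  simp only [dir]
  exact (f.linearMap_vsub _ _).symm

/-- Any linear map preserves parallelism; orthogonality survives because inner products are only
scaled. -/
theorem PolygonalPath.IsOrthoFin.map {γ : PolygonalPath} (h : γ.IsOrthoFin)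
    (f : Plane →ᵃ[ℝ] Plane) (hf : Function.Injective f)
    (hconf : ∃ k : ℝ, ∀ x y, inner ℝ (f.linear x) (f.linear y) = k * inner ℝ x y) :
    (γ.map f hf).IsOrthoFin := by
  obtain ⟨k, hk⟩ := hconf
  rcases h with ⟨c, hc⟩ | h
  · refine Or.inl ⟨c, ?_⟩
    have h1 := γ.dir_map f hf (Fin.last _)
    rw [hc, map_smul, ← γ.dir_map f hf 0] at h1
    exact h1
  · refine Or.inr ?_
    have h1 := hk (γ.dir 0) (γ.dir (Fin.last _))
    rw [h, mul_zero, ← γ.dir_map f hf, ← γ.dir_map f hf] at h1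
    exact h1

namespace PlaneMultigraph

variable {E E' : Type*}

/-- All points of the vertices and the edges. -/
def support (G : PlaneMultigraph E) : Set Plane := ↑G.verts ∪ ⋃ e, (G.edge e).carrier

/-- The image of a plane multigraph under an injective affine map. -/
noncomputable def map (G : PlaneMultigraph E) (f : Plane →ᵃ[ℝ] Plane)
    (hf : Function.Injective f) : PlaneMultigraph E where
  verts := G.verts.map ⟨f, hf⟩
  edge e := (G.edge e).map f hf
  source_mem e := Finset.mem_map_of_mem ⟨f, hf⟩ (G.source_mem e)
  target_mem e := Finset.mem_map_of_mem ⟨f, hf⟩ (G.target_mem e)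
  vertex_on_edge e v hv hve := by
    obtain ⟨w, hw, rfl⟩ := Finset.mem_map.1 hv
    rw [PolygonalPath.carrier_map] at hve
    exact (G.vertex_on_edge e w hw (hf.mem_set_image.1 hve)).imp (congrArg f) (congrArg f)
  edge_inter e e' hne := by
    rw [PolygonalPath.carrier_map, PolygonalPath.carrier_map, ← Set.image_inter hf,
      Finset.coe_map]
    exact Set.image_mono (G.edge_inter e e' hne)

theorem support_map (G : PlaneMultigraph E) (f : Plane →ᵃ[ℝ] Plane) (hf : Function.Injective f) :
    (G.map f hf).support = f '' G.support := by
  simp only [support, Set.image_union, Set.image_iUnion, ← PolygonalPath.carrier_map _ f hf]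
  simp [map]

theorem carrier_subset_support (G : PlaneMultigraph E) (e : E) :
    (G.edge e).carrier ⊆ G.support :=
  fun _ hx => Or.inr (Set.mem_iUnion.2 ⟨e, hx⟩)

open Classical in
/-- The union of two plane multigraphs that meet in a common vertex only. -/
noncomputable def glue (G : PlaneMultigraph E) (H : PlaneMultigraph E') (p : Plane)
    (hG : p ∈ G.verts) (hH : p ∈ H.verts) (h : G.support ∩ H.support ⊆ {p}) :
    PlaneMultigraph (E ⊕ E') where
  verts := G.verts ∪ H.verts
  edge := Sum.elim G.edge H.edge
  source_mem e := by
    rcases e with e | e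
    · exact Finset.mem_union_left _ (G.source_mem e)
    · exact Finset.mem_union_right _ (H.source_mem e)
  target_mem e := by
    rcases e with e | e
    · exact Finset.mem_union_left _ (G.target_mem e)
    · exact Finset.mem_union_right _ (H.target_mem e)
  vertex_on_edge e v hv hve := by
    rcases e with e | e
    · refine G.vertex_on_edge e v ?_ hve
      rcases Finset.mem_union.1 hv with h1 | h1
      · exact h1
      · obtain rfl := h ⟨G.carrier_subset_support e hve, Or.inl h1⟩
        exact hG
    · refine H.vertex_on_edge e v ?_ hve
      rcases Finset.mem_union.1 hv with h1 | h1
      · obtain rfl := h ⟨Or.inl h1, H.carrier_subset_support e hve⟩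
        exact hH
      · exact h1
  edge_inter e e' hne x hx := by
    rw [Finset.coe_union]
    rcases e with e | e <;> rcases e' with e' | e'
    · exact Or.inl (G.edge_inter e e' (fun h' => hne (congrArg _ h')) hx)
    · obtain rfl := h ⟨G.carrier_subset_support e hx.1, H.carrier_subset_support e' hx.2⟩
      exact Or.inl hG
    · obtain rfl := h ⟨G.carrier_subset_support e' hx.2, H.carrier_subset_support e hx.1⟩
      exact Or.inl hG
    · exact Or.inr (H.edge_inter e e' (fun h' => hne (congrArg _ h')) hx)

variable {G : PlaneMultigraph E} {H : PlaneMultigraph E'} {p : Plane}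
    (hG : p ∈ G.verts) (hH : p ∈ H.verts) (h : G.support ∩ H.support ⊆ {p})

theorem support_glue : (G.glue H p hG hH h).support = G.support ∪ H.support := by
  ext x
  simp only [support, glue, Finset.coe_union, Set.mem_union, Set.mem_iUnion, Sum.exists,
    Sum.elim_inl, Sum.elim_inr]
  tauto

theorem card_verts_glue :
    (G.glue H p hG hH h).verts.card + 1 = G.verts.card + H.verts.card := by
  classical
  have hint : G.verts ∩ H.verts = {p} := by
    ext x
    rw [Finset.mem_inter, Finset.mem_singleton]
    refine ⟨fun hx => h ⟨Or.inl hx.1, Or.inl hx.2⟩, ?_⟩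
    rintro rfl
    exact ⟨hG, hH⟩
  have := Finset.card_union_add_card_inter G.verts H.verts
  rw [hint, Finset.card_singleton] at this
  convert this using 2
  simp only [glue]

theorem IsOrthoFin.glue (h₁ : G.IsOrthoFin) (h₂ : H.IsOrthoFin) :
    (G.glue H p hG hH h).IsOrthoFin := by
  rintro (e | e)
  · exact h₁ e
  · exact h₂ e

end PlaneMultigraph

/-! ### Decidable intersection tests for lattice segments. -/

/-- The point of the plane with the given integer coordinates. -/
noncomputable def latticePoint (a : ℤ × ℤ) : Plane := !₂[(a.1 : ℝ), (a.2 : ℝ)]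

theorem latticePoint_injective : Function.Injective latticePoint := by
  intro a b h
  have h0 := congrFun (congrArg WithLp.ofLp h) 0
  have h1 := congrFun (congrArg WithLp.ofLp h) 1
  simp only [latticePoint, Matrix.cons_val_zero, Matrix.cons_val_one, Int.cast_inj] at h0 h1
  exact Prod.ext h0 h1

theorem exists_of_mem_lattice_segment {a b : ℤ × ℤ} {x : Plane}
    (h : x ∈ segment ℝ (latticePoint a) (latticePoint b)) : ∃ s t : ℝ, 0 ≤ s ∧ 0 ≤ t ∧ s + t = 1 ∧
      x 0 = s * a.1 + t * b.1 ∧ x 1 = s * a.2 + t * b.2 := by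
  obtain ⟨s, t, hs, ht, hst, rfl⟩ := h
  exact ⟨s, t, hs, ht, hst, by simp [latticePoint], by simp [latticePoint]⟩

/-- Twice the signed area of the triangle `a b c`. -/
def cross (a b c : ℤ × ℤ) : ℤ := (b.1 - a.1) * (c.2 - a.2) - (b.2 - a.2) * (c.1 - a.1)

/-- One of the segments `a b` and `c d` lies strictly on one side of the line through the other. -/
def Apart (a b c d : ℤ × ℤ) : Prop :=
  0 < cross a b c * cross a b d ∨ 0 < cross c d a * cross c d b

/-- A criterion for the segments `a b` and `c d` to have at most the point `q` in common. -/
def MeetAt (a b c d q : ℤ × ℤ) : Prop :=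
  Apart a b c d ∨ (c = q ∧ cross a b c = 0 ∧ cross a b d ≠ 0) ∨
    (d = q ∧ cross a b d = 0 ∧ cross a b c ≠ 0) ∨
    ((a = q ∨ b = q) ∧ (c = q ∨ d = q) ∧
      (a.1 + b.1 - 2 * q.1) * (c.1 + d.1 - 2 * q.1) +
        (a.2 + b.2 - 2 * q.2) * (c.2 + d.2 - 2 * q.2) < 0)

instance (a b c d : ℤ × ℤ) : Decidable (Apart a b c d) := by unfold Apart; infer_instance

instance (a b c d q : ℤ × ℤ) : Decidable (MeetAt a b c d q) := by unfold MeetAt; infer_instance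

/-- `cross a b` is affine in its last argument and vanishes on the line through `a` and `b`. -/
theorem cross_combination {a b c d : ℤ × ℤ} {x : Plane}
    (h : x ∈ segment ℝ (latticePoint a) (latticePoint b)) {s t : ℝ} (hst : s + t = 1)
    (h0 : x 0 = s * c.1 + t * d.1) (h1 : x 1 = s * c.2 + t * d.2) :
    s * cross a b c + t * cross a b d = 0 := by
  obtain ⟨u, v, -, -, huv, h2, h3⟩ := exists_of_mem_lattice_segment h
  obtain rfl : s = 1 - t := by linarith
  obtain rfl : u = 1 - v := by linarith
  rw [h2] at h0
  rw [h3] at h1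
  simp only [cross]
  push_cast
  linear_combination ((b.1 : ℝ) - a.1) * (-h1) + ((b.2 : ℝ) - a.2) * h0

theorem eq_latticePoint {x : Plane} {q : ℤ × ℤ} (h0 : x 0 = q.1) (h1 : x 1 = q.2) :
    x = latticePoint q := by
  ext i
  fin_cases i
  · simpa [latticePoint] using h0
  · simpa [latticePoint] using h1

theorem Apart.not_mem {a b c d : ℤ × ℤ} (h : Apart a b c d) {x : Plane}
    (hx : x ∈ segment ℝ (latticePoint a) (latticePoint b)) :
    x ∉ segment ℝ (latticePoint c) (latticePoint d) := by
  have main : ∀ a b c d : ℤ × ℤ, 0 < cross a b c * cross a b d →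
      x ∈ segment ℝ (latticePoint a) (latticePoint b) →
      x ∉ segment ℝ (latticePoint c) (latticePoint d) := by
    intro a b c d h hx hx'
    obtain ⟨s, t, hs, ht, hst, h0, h1⟩ := exists_of_mem_lattice_segment hx'
    have e := cross_combination hx hst h0 h1
    have h' : (0 : ℝ) < cross a b c * cross a b d := by exact_mod_cast h
    rcases pos_and_pos_or_neg_and_neg_of_mul_pos h' with ⟨h2, h3⟩ | ⟨h2, h3⟩
    · rcases hs.eq_or_lt with rfl | hs'
      · obtain rfl : t = 1 := by linarith
        linarith
      · nlinarith [mul_pos hs' h2, mul_nonneg ht h3.le]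
    · rcases hs.eq_or_lt with rfl | hs'
      · obtain rfl : t = 1 := by linarith
        linarith
      · nlinarith [mul_pos hs' (neg_pos.2 h2), mul_nonneg ht (neg_pos.2 h3).le]
  rcases h with h | h
  · exact main a b c d h hx
  · exact fun hx' => main c d a b h hx' hx

/-- As `q` is one of the endpoints, `a + b - 2q` is the vector from `q` to the other one; one
formula thus covers both orientations. -/
theorem exists_of_mem_lattice_segment_of_eq {a b q : ℤ × ℤ} (hq : a = q ∨ b = q) {x : Plane}
    (h : x ∈ segment ℝ (latticePoint a) (latticePoint b)) : ∃ t : ℝ, 0 ≤ t ∧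
      x 0 - q.1 = t * (a.1 + b.1 - 2 * q.1) ∧ x 1 - q.2 = t * (a.2 + b.2 - 2 * q.2) := by
  obtain ⟨s, t, hs, ht, hst, h0, h1⟩ := exists_of_mem_lattice_segment h
  rcases hq with rfl | rfl
  · obtain rfl : s = 1 - t := by linarith
    exact ⟨t, ht, by rw [h0]; ring, by rw [h1]; ring⟩
  · obtain rfl : t = 1 - s := by linarith
    exact ⟨s, hs, by rw [h0]; ring, by rw [h1]; ring⟩

theorem MeetAt.eq {a b c d q : ℤ × ℤ} (h : MeetAt a b c d q) {x : Plane}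
    (hx : x ∈ segment ℝ (latticePoint a) (latticePoint b))
    (hx' : x ∈ segment ℝ (latticePoint c) (latticePoint d)) : x = latticePoint q := by
  rcases h with h | ⟨rfl, hc, hd⟩ | ⟨rfl, hd, hc⟩ | ⟨hab, hcd, hlt⟩
  · exact absurd hx' (h.not_mem hx)
  · obtain ⟨s, t, hs, ht, hst, h0, h1⟩ := exists_of_mem_lattice_segment hx'
    have e := cross_combination hx hst h0 h1
    rw [hc, Int.cast_zero, mul_zero, zero_add] at e
    have ht0 : t = 0 := (mul_eq_zero.1 e).resolve_right (by exact_mod_cast hd)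
    obtain rfl : s = 1 := by linarith
    subst ht0
    exact eq_latticePoint (by linarith) (by linarith)
  · obtain ⟨s, t, hs, ht, hst, h0, h1⟩ := exists_of_mem_lattice_segment hx'
    have e := cross_combination hx hst h0 h1
    rw [hd, Int.cast_zero, mul_zero, add_zero] at e
    have hs0 : s = 0 := (mul_eq_zero.1 e).resolve_right (by exact_mod_cast hc)
    obtain rfl : t = 1 := by linarith
    subst hs0
    exact eq_latticePoint (by linarith) (by linarith)
  · obtain ⟨t, ht, h0, h1⟩ := exists_of_mem_lattice_segment_of_eq hab hx
    obtain ⟨u, hu, h2, h3⟩ := exists_of_mem_lattice_segment_of_eq hcd hx'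
    have hlt' : ((a.1 : ℝ) + b.1 - 2 * q.1) * (c.1 + d.1 - 2 * q.1) +
        (a.2 + b.2 - 2 * q.2) * (c.2 + d.2 - 2 * q.2) < 0 := by
      exact_mod_cast hlt
    -- The segments leave `q` at an obtuse angle, so the squared distance from `q` to a common point
    -- is a nonnegative multiple of a negative number.
    have h4 : (x 0 - q.1) ^ 2 + (x 1 - q.2) ^ 2 =
        t * u * (((a.1 : ℝ) + b.1 - 2 * q.1) * (c.1 + d.1 - 2 * q.1) +
        (a.2 + b.2 - 2 * q.2) * (c.2 + d.2 - 2 * q.2)) := by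
      rw [sq, sq]
      nth_rewrite 1 [h0]
      nth_rewrite 1 [h1]
      rw [h2, h3]
      ring
    have h5 := mul_nonpos_of_nonneg_of_nonpos (mul_nonneg ht hu) hlt'.le
    rw [← h4] at h5
    have h6 : x 0 - q.1 = 0 := by nlinarith [sq_nonneg (x 0 - q.1), sq_nonneg (x 1 - q.2)]
    have h7 : x 1 - q.2 = 0 := by nlinarith [sq_nonneg (x 0 - q.1), sq_nonneg (x 1 - q.2)]
    exact eq_latticePoint (by linarith) (by linarith)

/-- A polygonal path through lattice points. -/
noncomputable def latticePath (k : ℕ) (p : Fin (k + 2) → ℤ × ℤ)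
    (hne : ∀ i : Fin (k + 1), p i.castSucc ≠ p i.succ)
    (hs : ∀ i j : Fin (k + 1), i < j →
      Apart (p i.castSucc) (p i.succ) (p j.castSucc) (p j.succ) ∨
      (i.succ = j.castSucc ∧ MeetAt (p i.castSucc) (p i.succ) (p j.castSucc) (p j.succ) (p i.succ)) ∨
      (i = 0 ∧ j = Fin.last k ∧ p 0 = p (Fin.last (k + 1)) ∧
        MeetAt (p i.castSucc) (p i.succ) (p j.castSucc) (p j.succ) (p 0))) : PolygonalPath where
  bends := k
  pt i := latticePoint (p i)
  pt_ne i h := hne i (latticePoint_injective h)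
  simple i j hij x hi hj := by
    rcases hs i j hij with h | ⟨h, h'⟩ | ⟨h1, h2, h3, h4⟩
    · exact absurd hj (h.not_mem hi)
    · exact Or.inl ⟨h, h'.eq hi hj⟩
    · have h5 := h4.eq hi hj
      exact Or.inr ⟨h1, h2, h5, by rw [← h3]; exact h5⟩

/-! ### The five-edge building block. -/

/-- The number of bends of the edges of `gadget`. -/
def gadgetBends : Fin 5 → ℕ := ![2, 3, 3, 0, 1]

/-- The points of the edges of `gadget`: three loops and two parallel edges. -/
def gadgetPt (e : Fin 5) (i : ℕ) : ℤ × ℤ :=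
  -- The loops leave `(56, 8)` at angles 0 and 90, 135 and -45, 180 and 270 degrees. The last two
  -- edges arrive in the free quadrant. The default value is never reached for `i ≤ gadgetBends e +
  -- 1`.
  ((![[(56, 8), (57, 8), (56, 9), (56, 8)],
    [(56, 8), (55, 9), (58, 10), (57, 7), (56, 8)],
    [(56, 8), (52, 8), (64, 16), (56, 4), (56, 8)],
    [(0, 0), (56, 8)],
    [(0, 0), (48, -16), (56, 8)]] : Fin 5 → List (ℤ × ℤ)) e).getD i (0, 0)

/-- The edges of `gadget`. -/
noncomputable def gadgetEdge (e : Fin 5) : PolygonalPath :=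
  latticePath (gadgetBends e) (fun i => gadgetPt e i) (by revert e; decide) (by revert e; decide)

/-- With the degenerate segment `v v`, `Apart` means that `v` lies off the line of the edge segment.
-/
theorem gadget_vertex : ∀ e, ∀ v ∈ ({(0, 0), (56, 8)} : Finset (ℤ × ℤ)),
    v = gadgetPt e 0 ∨ v = gadgetPt e (gadgetBends e + 1) ∨
      ∀ i : Fin (gadgetBends e + 1), Apart (gadgetPt e i) (gadgetPt e (i + 1)) v v := by
  decide

theorem gadget_inter : ∀ e f, e ≠ f → ∀ (i : Fin (gadgetBends e + 1)) (j : Fin (gadgetBends f + 1)),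
    MeetAt (gadgetPt e i) (gadgetPt e (i + 1)) (gadgetPt f j) (gadgetPt f (j + 1)) (56, 8) ∨
      MeetAt (gadgetPt e i) (gadgetPt e (i + 1)) (gadgetPt f j) (gadgetPt f (j + 1)) (0, 0) := by
  decide

theorem gadgetEdge_mem_carrier {e : Fin 5} {x : Plane} : x ∈ (gadgetEdge e).carrier ↔
    ∃ i : Fin (gadgetBends e + 1),
      x ∈ segment ℝ (latticePoint (gadgetPt e i)) (latticePoint (gadgetPt e (i + 1))) :=
  PolygonalPath.mem_carrier

/-- Two vertices `(0, 0)` and `(56, 8)`, three loops at the latter and two edges between them. -/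
noncomputable def gadget : PlaneMultigraph (Fin 5) where
  verts := ({(0, 0), (56, 8)} : Finset (ℤ × ℤ)).map ⟨latticePoint, latticePoint_injective⟩
  edge := gadgetEdge
  source_mem e := Finset.mem_map_of_mem ⟨_, latticePoint_injective⟩
    (show gadgetPt e 0 ∈ _ by revert e; decide)
  target_mem e := Finset.mem_map_of_mem ⟨_, latticePoint_injective⟩
    (show gadgetPt e (gadgetBends e + 1) ∈ _ by revert e; decide)
  vertex_on_edge e v hv hve := by
    obtain ⟨w, hw, rfl⟩ := Finset.mem_map.1 hv
    obtain ⟨i, hi⟩ := gadgetEdge_mem_carrier.1 hve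
    rcases gadget_vertex e w hw with h | h | h
    · exact Or.inl (congrArg latticePoint h)
    · exact Or.inr (congrArg latticePoint h)
    · exact absurd (left_mem_segment ℝ _ _) ((h i).not_mem hi)
  edge_inter e f hne x hx := by
    obtain ⟨i, hi⟩ := gadgetEdge_mem_carrier.1 hx.1
    obtain ⟨j, hj⟩ := gadgetEdge_mem_carrier.1 hx.2
    rw [Finset.coe_map]
    rcases gadget_inter e f hne i j with h | h
    · exact ⟨(56, 8), by simp, (h.eq hi hj).symm⟩
    · exact ⟨(0, 0), by simp, (h.eq hi hj).symm⟩

theorem gadget_isOrthoFin : gadget.IsOrthoFin := by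
  have key : ∀ e : Fin 5,
      (gadgetPt e (gadgetBends e + 1) - gadgetPt e (gadgetBends e) = gadgetPt e 1 - gadgetPt e 0) ∨
      ((gadgetPt e 1).1 - (gadgetPt e 0).1) *
          ((gadgetPt e (gadgetBends e + 1)).1 - (gadgetPt e (gadgetBends e)).1) +
        ((gadgetPt e 1).2 - (gadgetPt e 0).2) *
          ((gadgetPt e (gadgetBends e + 1)).2 - (gadgetPt e (gadgetBends e)).2) = 0 := by
    decide
  intro e
  have h0 : (gadget.edge e).dir 0 = latticePoint (gadgetPt e 1) - latticePoint (gadgetPt e 0) := rfl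
  have h1 : (gadget.edge e).dir (Fin.last _) = latticePoint (gadgetPt e (gadgetBends e + 1)) -
    latticePoint (gadgetPt e (gadgetBends e)) := rfl
  have hsub : ∀ a b, latticePoint a - latticePoint b = latticePoint (a - b) := by
    intro a b
    ext i
    fin_cases i <;> simp [latticePoint]
  rw [PolygonalPath.IsOrthoFin, h0, h1, hsub, hsub]
  rcases key e with h | h
  · exact Or.inl ⟨1, by rw [h, one_smul]⟩
  · right
    simp only [latticePoint, PiLp.inner_apply, Fin.sum_univ_two, Matrix.cons_val_zero,
      Matrix.cons_val_one, RCLike.inner_apply, conj_trivial, Prod.fst_sub, Prod.snd_sub]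
    rw [mul_comm ((_ : ℤ) : ℝ), mul_comm (((gadgetPt e (gadgetBends e + 1)).2 - _ : ℤ) : ℝ)]
    exact_mod_cast h

theorem le_of_mem_lattice_segment (α β c : ℤ) {a b : ℤ × ℤ} (ha : c ≤ α * a.1 + β * a.2)
    (hb : c ≤ α * b.1 + β * b.2) {x : Plane}
    (h : x ∈ segment ℝ (latticePoint a) (latticePoint b)) : (c : ℝ) ≤ α * x 0 + β * x 1 := by
  obtain ⟨s, t, hs, ht, hst, h0, h1⟩ := exists_of_mem_lattice_segment h
  have ha' : (c : ℝ) ≤ α * a.1 + β * a.2 := by exact_mod_cast ha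
  have hb' : (c : ℝ) ≤ α * b.1 + β * b.2 := by exact_mod_cast hb
  have e : α * x 0 + β * x 1 - c =
      s * (α * a.1 + β * a.2 - c) + t * (α * b.1 + β * b.2 - c) := by
    rw [h0, h1]
    obtain rfl : s = 1 - t := by linarith
    ring
  nlinarith [mul_nonneg hs (sub_nonneg.2 ha'), mul_nonneg ht (sub_nonneg.2 hb')]

/-- A triangle with apex `(0, 0)`. -/
def wedge : Set Plane := {x | -(2 * x 0) ≤ 5 * x 1 ∧ 5 * x 1 ≤ 2 * x 0 ∧ x 0 ≤ 64}

theorem mem_gadget_support {x : Plane} (hx : x ∈ gadget.support) :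
    ∃ (e : Fin 5) (i : Fin (gadgetBends e + 1)),
      x ∈ segment ℝ (latticePoint (gadgetPt e i)) (latticePoint (gadgetPt e (i + 1))) := by
  rcases hx with hx | hx
  · obtain ⟨w, hw, rfl⟩ := Finset.mem_map.1 hx
    rcases Finset.mem_insert.1 hw with rfl | hw
    · exact ⟨3, 0, left_mem_segment ℝ _ _⟩
    · obtain rfl := Finset.mem_singleton.1 hw
      exact ⟨3, 0, right_mem_segment ℝ _ _⟩
  · obtain ⟨e, he⟩ := Set.mem_iUnion.1 hx
    obtain ⟨i, hi⟩ := gadgetEdge_mem_carrier.1 he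
    exact ⟨e, i, hi⟩

theorem gadget_support_subset : gadget.support ⊆ wedge := by
  have key : ∀ e, ∀ i ∈ Finset.range (gadgetBends e + 2),
      0 ≤ 2 * (gadgetPt e i).1 + 5 * (gadgetPt e i).2 ∧
      0 ≤ 2 * (gadgetPt e i).1 + (-5) * (gadgetPt e i).2 ∧
      -64 ≤ (-1) * (gadgetPt e i).1 + 0 * (gadgetPt e i).2 := by
    decide
  intro x hx
  obtain ⟨e, i, hi⟩ := mem_gadget_support hx
  have ha := key e i (Finset.mem_range.2 (by omega))
  have hb := key e (i + 1) (Finset.mem_range.2 (by omega))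
  have h1 := le_of_mem_lattice_segment _ _ _ ha.1 hb.1 hi
  have h2 := le_of_mem_lattice_segment _ _ _ ha.2.1 hb.2.1 hi
  have h3 := le_of_mem_lattice_segment _ _ _ ha.2.2 hb.2.2 hi
  push_cast at h1 h2 h3
  exact ⟨by linarith, by linarith, by linarith⟩

/-! ### Self-similar iteration and sharpness. -/

/-- The similarity that maps `(0, 0)` to `(56, 8)` and rotates by `225` degrees. -/
noncomputable def shrink : Plane →ᵃ[ℝ] Plane where
  toFun x := !₂[56 - (x 0 - x 1) / 8, 8 - (x 0 + x 1) / 8]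
  linear :=
    { toFun := fun x => !₂[-((x 0 - x 1) / 8), -((x 0 + x 1) / 8)]
      map_add' := by
        intro x y
        ext i
        fin_cases i <;> simp <;> ring
      map_smul' := by
        intro c x
        ext i
        fin_cases i <;> simp <;> ring }
  map_vadd' := by
    intro p v
    ext i
    fin_cases i <;> simp <;> ring

theorem shrink_apply_zero (x : Plane) : shrink x 0 = 56 - (x 0 - x 1) / 8 := rfl

theorem shrink_apply_one (x : Plane) : shrink x 1 = 8 - (x 0 + x 1) / 8 := rfl

theorem shrink_injective : Function.Injective shrink := by
  intro x y h
  have h0 := congrFun (congrArg WithLp.ofLp h) 0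
  have h1 := congrFun (congrArg WithLp.ofLp h) 1
  rw [shrink_apply_zero, shrink_apply_zero] at h0
  rw [shrink_apply_one, shrink_apply_one] at h1
  ext i
  fin_cases i
  · change x 0 = y 0
    linarith
  · change x 1 = y 1
    linarith

theorem shrink_conformal :
    ∃ k : ℝ, ∀ x y, inner ℝ (shrink.linear x) (shrink.linear y) = k * inner ℝ x y := by
  -- The similarity ratio is `√2 / 8`, with square `1 / 32`.
  refine ⟨1 / 32, fun x y => ?_⟩
  simp only [shrink, PiLp.inner_apply, Fin.sum_univ_two, LinearMap.coe_mk, AddHom.coe_mk,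
    Matrix.cons_val_zero, Matrix.cons_val_one, RCLike.inner_apply, conj_trivial]
  ring

theorem shrink_latticePoint_zero : shrink (latticePoint (0, 0)) = latticePoint (56, 8) := by
  refine eq_latticePoint ?_ ?_
  · rw [shrink_apply_zero]; simp [latticePoint]
  · rw [shrink_apply_one]; simp [latticePoint]

theorem shrink_mem_wedge {x : Plane} (hx : x ∈ wedge) : shrink x ∈ wedge := by
  obtain ⟨h1, h2, h3⟩ := hx
  refine ⟨?_, ?_, ?_⟩ <;> simp only [shrink_apply_zero, shrink_apply_one] <;> linarith

/-- The shrunken wedge fits into the free angle at `(56, 8)` between the two parallel edges. -/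
theorem shrink_wedge_inter_gadget {x : Plane} (hx : x ∈ wedge) (h : shrink x ∈ gadget.support) :
    shrink x = latticePoint (56, 8) := by
  -- Each segment lies in one of five half-planes. Four have `(56, 8)` on their boundary and meet
  -- the shrunken wedge only there; the fifth misses it.
  have key : ∀ e, ∀ i : Fin (gadgetBends e + 1),
      (56 ≤ 1 * (gadgetPt e i).1 + 0 * (gadgetPt e i).2 ∧
        56 ≤ 1 * (gadgetPt e (i + 1)).1 + 0 * (gadgetPt e (i + 1)).2) ∨
      (8 ≤ 0 * (gadgetPt e i).1 + 1 * (gadgetPt e i).2 ∧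
        8 ≤ 0 * (gadgetPt e (i + 1)).1 + 1 * (gadgetPt e (i + 1)).2) ∨
      (0 ≤ (-1) * (gadgetPt e i).1 + 7 * (gadgetPt e i).2 ∧
        0 ≤ (-1) * (gadgetPt e (i + 1)).1 + 7 * (gadgetPt e (i + 1)).2) ∨
      (160 ≤ 3 * (gadgetPt e i).1 + (-1) * (gadgetPt e i).2 ∧
        160 ≤ 3 * (gadgetPt e (i + 1)).1 + (-1) * (gadgetPt e (i + 1)).2) ∨
      (0 ≤ (-1) * (gadgetPt e i).1 + (-3) * (gadgetPt e i).2 ∧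
        0 ≤ (-1) * (gadgetPt e (i + 1)).1 + (-3) * (gadgetPt e (i + 1)).2) := by
    decide
  obtain ⟨e, i, hi⟩ := mem_gadget_support h
  obtain ⟨h1, h2, h3⟩ := hx
  have hx0 : x 0 ≤ 0 := by
    rcases key e i with h | h | h | h | h <;>
    · have h4 := le_of_mem_lattice_segment _ _ _ h.1 h.2 hi
      rw [shrink_apply_zero, shrink_apply_one] at h4
      push_cast at h4
      linarith
  refine eq_latticePoint ?_ ?_
  · rw [shrink_apply_zero]
    push_cast
    linarith
  · rw [shrink_apply_one]
    push_cast
    linarith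

theorem latticePoint_zero_mem_wedge : latticePoint (0, 0) ∈ wedge := by
  refine ⟨?_, ?_, ?_⟩ <;> simp [latticePoint]

theorem mem_gadget_verts : latticePoint (56, 8) ∈ gadget.verts :=
  Finset.mem_map_of_mem ⟨_, latticePoint_injective⟩ (by decide)

theorem PlaneMultigraph.map_shrink_inter {E E' : Type*} {G : PlaneMultigraph E}
    (hG : G.support ⊆ wedge) {H : PlaneMultigraph E'} (hH : H.support ⊆ gadget.support) :
    (G.map shrink shrink_injective).support ∩ H.support ⊆ {latticePoint (56, 8)} := by
  rintro y ⟨hy, hy'⟩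
  rw [support_map] at hy
  obtain ⟨x, hx, rfl⟩ := hy
  exact shrink_wedge_inter_gadget (hG hx) (hH hy')

theorem PlaneMultigraph.mem_verts_map_shrink {E : Type*} {G : PlaneMultigraph E}
    (hG : latticePoint (0, 0) ∈ G.verts) :
    latticePoint (56, 8) ∈ (G.map shrink shrink_injective).verts := by
  rw [← shrink_latticePoint_zero]
  exact Finset.mem_map_of_mem ⟨_, shrink_injective⟩ hG

/-- Containment in the wedge with a vertex at its apex is the invariant that lets the drawing be
shrunk and glued in again. The new apex is the other vertex of `gadget`. -/
theorem exists_orthoFin_in_wedge (n : ℕ) :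
    ∃ (E : Type) (_ : Fintype E) (G : PlaneMultigraph E), Fintype.card E = 5 * n ∧
      G.verts.card = n + 1 ∧ G.IsOrthoFin ∧ latticePoint (0, 0) ∈ G.verts ∧ G.support ⊆ wedge := by
  induction n with
  | zero =>
    refine ⟨Empty, inferInstance, ⟨{latticePoint (0, 0)}, Empty.elim, fun e => e.elim,
      fun e => e.elim, fun e => e.elim, fun e => e.elim⟩, rfl, rfl, fun e => e.elim, by simp, ?_⟩
    rintro x (hx | hx)
    · obtain rfl : x = latticePoint (0, 0) := by simpa using hx
      exact latticePoint_zero_mem_wedge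
    · simp at hx
  | succ n ih =>
    obtain ⟨E, _, G, hE, hcard, hortho, h0, hsub⟩ := ih
    have hG := PlaneMultigraph.mem_verts_map_shrink h0
    have hint := PlaneMultigraph.map_shrink_inter hsub (subset_refl gadget.support)
    refine ⟨E ⊕ Fin 5, inferInstance,
      (G.map shrink shrink_injective).glue gadget _ hG mem_gadget_verts hint, ?_, ?_, ?_, ?_, ?_⟩
    · rw [Fintype.card_sum, hE, Fintype.card_fin]
      ring
    · have h1 := PlaneMultigraph.card_verts_glue hG mem_gadget_verts hint
      have h2 : (G.map shrink shrink_injective).verts.card = n + 1 := by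
        rw [← hcard]
        exact Finset.card_map _
      have h3 : gadget.verts.card = 2 := Finset.card_map _
      omega
    · exact PlaneMultigraph.IsOrthoFin.glue hG mem_gadget_verts hint
        (fun e => (hortho e).map shrink shrink_injective shrink_conformal) gadget_isOrthoFin
    · classical
      refine Finset.mem_union_right _ ?_
      exact Finset.mem_map_of_mem ⟨_, latticePoint_injective⟩ (by decide)
    · rw [PlaneMultigraph.support_glue, PlaneMultigraph.support_map]
      refine Set.union_subset ?_ gadget_support_subset
      rintro _ ⟨x, hx, rfl⟩
      exact shrink_mem_wedge (hsub hx)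

/-- One vertex with three loops. -/
noncomputable def gadgetLoops : PlaneMultigraph (Fin 3) :=
  gadget.restrict (Fin.castLEEmb (by decide)) {latticePoint (56, 8)}
    (Finset.singleton_subset_iff.2 mem_gadget_verts)
    (fun e => Finset.mem_singleton.2 (congrArg latticePoint
      (show gadgetPt (Fin.castLEEmb (by decide) e) 0 = (56, 8) by revert e; decide)))
    (fun e => Finset.mem_singleton.2 (congrArg latticePoint
      (show gadgetPt (Fin.castLEEmb (by decide) e) (gadgetBends (Fin.castLEEmb (by decide) e) + 1) =
        (56, 8) by revert e; decide)))

theorem gadgetLoops_support_subset : gadgetLoops.support ⊆ gadget.support := by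
  rintro x (hx | hx)
  · left
    obtain rfl : x = latticePoint (56, 8) := by simpa [gadgetLoops, PlaneMultigraph.restrict] using hx
    exact mem_gadget_verts
  · right
    obtain ⟨e, he⟩ := Set.mem_iUnion.1 hx
    exact Set.mem_iUnion.2 ⟨_, he⟩

/-- The outermost vertex still has a free angle outside the shrunken wedge; the three loops fill it
without adding a vertex. -/
theorem exists_orthoFin_card_eq (n : ℕ) (hn : 1 ≤ n) :
    ∃ G : PlaneMultigraph (Fin (5 * n - 2)), G.IsOrthoFin ∧ G.verts.card = n := by
  obtain ⟨m, rfl⟩ : ∃ m, n = m + 1 := ⟨n - 1, by omega⟩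
  obtain ⟨E, _, G, hE, hcard, hortho, h0, hsub⟩ := exists_orthoFin_in_wedge m
  have hG := PlaneMultigraph.mem_verts_map_shrink h0
  have hL : latticePoint (56, 8) ∈ gadgetLoops.verts := Finset.mem_singleton_self _
  have hint := PlaneMultigraph.map_shrink_inter hsub gadgetLoops_support_subset
  set U := (G.map shrink shrink_injective).glue gadgetLoops _ hG hL hint with hU
  have hUortho : U.IsOrthoFin := PlaneMultigraph.IsOrthoFin.glue hG hL hint
    (fun e => (hortho e).map shrink shrink_injective shrink_conformal)
    (fun e => gadget_isOrthoFin _)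
  have hc : Fintype.card (Fin (5 * (m + 1) - 2)) = Fintype.card (E ⊕ Fin 3) := by
    rw [Fintype.card_sum, hE, Fintype.card_fin, Fintype.card_fin]
    omega
  refine ⟨U.restrict (Fintype.equivOfCardEq hc).toEmbedding U.verts subset_rfl
    (fun e => U.source_mem _) (fun e => U.target_mem _), fun e => hUortho _, ?_⟩
  have h1 : U.verts.card + 1 = (G.map shrink shrink_injective).verts.card +
      gadgetLoops.verts.card := PlaneMultigraph.card_verts_glue hG hL hint
  have h2 : (G.map shrink shrink_injective).verts.card = m + 1 := by
    rw [← hcard]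
    exact Finset.card_map _
  have h3 : gadgetLoops.verts.card = 1 := Finset.card_singleton _
  change U.verts.card = m + 1
  rw [h2, h3] at h1
  omega

theorem theorem2 (n : ℕ) (hn : 1 ≤ n) :
    (∀ (E : Type*) (G : PlaneMultigraph E), G.IsOrthoFin → G.verts.card = n →
      Finite E ∧ Nat.card E ≤ 5 * n - 2) ∧
    (∃ G : PlaneMultigraph (Fin (5 * n - 2)), G.IsOrthoFin ∧ G.verts.card = n) := by
  refine ⟨fun E G hG hn => ?_, exists_orthoFin_card_eq n hn⟩
  subst hn
  exact hG.finite_and_card_le
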